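/- Let $G$ be a compact Lie group with a bi-invariant Riemannian metric $ds^2_G$, let $G\times G$ carry the metric $ds^2_{G\times G}=2(ds^2_G\oplus ds^2_G)$, and let $m:G\times G\to G$, $m(x,y)=xy$, be the multiplication map. Then: 1. $m$ is a Riemannian submersion, that is, $m$ is a surjective smooth map, $dm_p:T_p(G\times G)\to T_{m(p)}G$ is surjective for every $p\in G\times G$, and $dm_p$ maps $(\ker dm_p)^\perp$ isometrically onto $T_{m(p)}G$. 2. The fibers $m^{-1}(h)$, $h\in G$, are totally geodesic submanifolds of $G\times G$ (their second fundamental forms vanish). 3. For a Riemannian manifold $M$ let $\Delta^0_M=\delta d$ be the Laplace-Beltrami operator on smooth complex-valued functions, and for $\lambda\in\mathbb{R}$ let $E_\lambda(\Delta^0_M)=\{\phi\in C^\infty(M;\mathbb{C}):\Delta^0_M\phi=\lambda\phi\}$. Then $m^*\{E_\lambda(\Delta^0_G)\}\subset E_\lambda(\Delta^0_{G\times G})$ for every $\lambda\in\mathbb{R}$, where $m^*\phi=\phi\circ m$. -/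

import Mathlib

open Bundle
open scoped Manifold ContDiff

noncomputable section

namespace RiemGeom

set_option linter.unusedSectionVars false

variable {E : Type*} [NormedAddCommGroup E] [NormedSpace ℝ E] [FiniteDimensional ℝ E]
  {H : Type*} [TopologicalSpace H] {I : ModelWithCorners ℝ E H}
  {M : Type*} [TopologicalSpace M] [ChartedSpace H M] [IsManifold I ∞ M]

/-- Smooth Riemannian metrics on the manifold `M`. -/
abbrev RiemMetric (I : ModelWithCorners ℝ E H) (M : Type*) [TopologicalSpace M] [ChartedSpace H M]
    [IsManifold I ∞ M] :=
  ContMDiffRiemannianMetric I ∞ E (TangentSpace I : M → Type _)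

/-- Smooth vector fields on `M`. -/
def IsSmoothVF (X : Π x : M, TangentSpace I x) : Prop :=
  ContMDiff I (I.prod 𝓘(ℝ, E)) ∞ (fun x => (⟨x, X x⟩ : TangentBundle I M))

theorem mdiff_inner (g : RiemMetric I M) {X Y : Π x : M, TangentSpace I x} {x : M}
    (hX : MDiffAt (T% X) x) (hY : MDiffAt (T% Y) x) :
    MDiffAt (fun y => g.inner y (X y) (Y y)) x := by
  have h : MDifferentiableAt I (I.prod 𝓘(ℝ)) (fun y =>
      TotalSpace.mk' ℝ (E := Bundle.Trivial M ℝ) y (g.inner y (X y) (Y y))) x :=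
    MDifferentiableAt.clm_bundle_apply₂ (F₁ := E) (F₂ := E)
      (g.contMDiff.mdifferentiableAt (by simp)) hX hY
  simp only [mdifferentiableAt_totalSpace] at h
  exact h.2

/-- Half of the right-hand side of the Koszul formula, so that `g (∇_X Y, Z) = koszul g X Y Z`
for the Levi-Civita connection. -/
def koszul (g : RiemMetric I M) (X Y Z : Π x : M, TangentSpace I x) (x : M) : ℝ :=
  (mvfderiv I (fun y => g.inner y (Y y) (Z y)) x (X x)
    + mvfderiv I (fun y => g.inner y (Z y) (X y)) x (Y x)
    - mvfderiv I (fun y => g.inner y (X y) (Y y)) x (Z x)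
    + g.inner x (VectorField.mlieBracket I X Y x) (Z x)
    - g.inner x (VectorField.mlieBracket I Y Z x) (X x)
    + g.inner x (VectorField.mlieBracket I Z X x) (Y x)) / 2

theorem koszul_tensorial_left (g : RiemMetric I M) {Y Z : Π x : M, TangentSpace I x} {x : M}
    (hY : MDiffAt (T% Y) x) (hZ : MDiffAt (T% Z) x) :
    TensorialAt I E (fun X => koszul g X Y Z x) x where
  smul {f X} hf hX := by
    have e1 : (fun y => g.inner y (Z y) ((f • X) y)) = fun y => f y * g.inner y (Z y) (X y) := by
      ext y; simp
    have e2 : (fun y => g.inner y ((f • X) y) (Y y)) = fun y => f y * g.inner y (X y) (Y y) := by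
      ext y; simp
    simp only [koszul]
    rw [e1, e2, mvfderiv_fun_mul hf (mdiff_inner g hZ hX), mvfderiv_fun_mul hf (mdiff_inner g hX hY),
      VectorField.mlieBracket_smul_left hf hX, VectorField.mlieBracket_smul_right hf hX]
    simp [g.symm x (Z x) (X x)]
    ring
  add {X X'} hX hX' := by
    have e1 : (fun y => g.inner y (Z y) ((X + X') y)) =
      fun y => g.inner y (Z y) (X y) + g.inner y (Z y) (X' y) := by ext y; simp
    have e2 : (fun y => g.inner y ((X + X') y) (Y y)) =
      fun y => g.inner y (X y) (Y y) + g.inner y (X' y) (Y y) := by ext y; simp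
    simp only [koszul]
    rw [e1, e2, mvfderiv_fun_add (mdiff_inner g hZ hX) (mdiff_inner g hZ hX'),
      mvfderiv_fun_add (mdiff_inner g hX hY) (mdiff_inner g hX' hY),
      VectorField.mlieBracket_add_left hX hX', VectorField.mlieBracket_add_right hX hX']
    simp
    ring

theorem koszul_tensorial_right (g : RiemMetric I M) {X Y : Π x : M, TangentSpace I x} {x : M}
    (hX : MDiffAt (T% X) x) (hY : MDiffAt (T% Y) x) :
    TensorialAt I E (fun Z => koszul g X Y Z x) x where
  smul {f Z} hf hZ := by
    have e1 : (fun y => g.inner y ((f • Z) y) (X y)) = fun y => f y * g.inner y (Z y) (X y) := by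
      ext y; simp
    have e2 : (fun y => g.inner y (Y y) ((f • Z) y)) = fun y => f y * g.inner y (Y y) (Z y) := by
      ext y; simp
    simp only [koszul]
    rw [e1, e2, mvfderiv_fun_mul hf (mdiff_inner g hZ hX), mvfderiv_fun_mul hf (mdiff_inner g hY hZ),
      VectorField.mlieBracket_smul_left hf hZ, VectorField.mlieBracket_smul_right hf hZ]
    simp [g.symm x (Z x) (X x), g.symm x (Z x) (Y x)]
    ring
  add {Z Z'} hZ hZ' := by
    have e1 : (fun y => g.inner y ((Z + Z') y) (X y)) =
      fun y => g.inner y (Z y) (X y) + g.inner y (Z' y) (X y) := by ext y; simp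
    have e2 : (fun y => g.inner y (Y y) ((Z + Z') y)) =
      fun y => g.inner y (Y y) (Z y) + g.inner y (Y y) (Z' y) := by ext y; simp
    simp only [koszul]
    rw [e1, e2, mvfderiv_fun_add (mdiff_inner g hZ hX) (mdiff_inner g hZ' hX),
      mvfderiv_fun_add (mdiff_inner g hY hZ) (mdiff_inner g hY hZ'),
      VectorField.mlieBracket_add_left hZ hZ', VectorField.mlieBracket_add_right hZ hZ']
    simp
    ring

instance finiteDimensional_tangentSpace (x : M) : FiniteDimensional ℝ (TangentSpace I x) :=
  inferInstanceAs (FiniteDimensional ℝ E)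

instance t2Space_tangentSpace (x : M) : T2Space (TangentSpace I x) :=
  inferInstanceAs (T2Space E)

/-- The musical isomorphism `v ↦ g(v, ·)`. -/
def flat (g : RiemMetric I M) (x : M) : TangentSpace I x ≃ₗ[ℝ] (TangentSpace I x →L[ℝ] ℝ) :=
  LinearEquiv.ofInjectiveOfFinrankEq (g.inner x).toLinearMap
    (by
      refine (injective_iff_map_eq_zero _).2 fun v hv => ?_
      by_contra hne
      have h := g.pos x v hne
      have h0 : g.inner x v v = 0 := by
        change (g.inner x) v = 0 at hv
        rw [hv]; rfl
      linarith)
    (by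
      rw [← (LinearMap.toContinuousLinearMap (𝕜 := ℝ) (E := TangentSpace I x)
        (F' := ℝ)).finrank_eq]
      exact Subspace.dual_finrank_eq.symm)

theorem ext_of_inner_mdiff (g : RiemMetric I M) {x : M} {v w : TangentSpace I x}
    (h : ∀ Z : Π x : M, TangentSpace I x, MDiffAt (T% Z) x →
      g.inner x v (Z x) = g.inner x w (Z x)) : v = w := by
  apply (flat g x).injective
  ext u
  change g.inner x v u = g.inner x w u
  have := h (FiberBundle.extend E u) (FiberBundle.mdifferentiableAt_extend ..)
  simpa using this

open Classical in
/-- The map `v ↦ ∇_v Y` at the point `x`, for a vector field `Y` that is differentiable at `x`. It is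
the unique one that satisfies the Koszul formula. -/
def leviCivitaFun (g : RiemMetric I M) (Y : Π x : M, TangentSpace I x) (x : M) :
    TangentSpace I x →L[ℝ] TangentSpace I x :=
  if hY : MDiffAt (T% Y) x then
    LinearMap.toContinuousLinearMap ((flat g x).symm.toLinearMap ∘ₗ
      (TensorialAt.mkHom₂ (fun X Z => koszul g X Y Z x) x
        (fun _ hZ => koszul_tensorial_left g hY hZ)
        (fun _ hX => koszul_tensorial_right g hX hY)).toLinearMap)
  else 0

theorem inner_leviCivitaFun (g : RiemMetric I M) {X Y Z : Π x : M, TangentSpace I x} {x : M}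
    (hX : MDiffAt (T% X) x) (hY : MDiffAt (T% Y) x) (hZ : MDiffAt (T% Z) x) :
    g.inner x (leviCivitaFun g Y x (X x)) (Z x) = koszul g X Y Z x := by
  have e (v : TangentSpace I x) : g.inner x v = flat g x v := rfl
  rw [leviCivitaFun, dif_pos hY, e]
  simp only [LinearMap.coe_toContinuousLinearMap', LinearMap.comp_apply, LinearEquiv.coe_coe,
    LinearEquiv.apply_symm_apply]
  exact TensorialAt.mkHom₂_apply (Φ := fun X Z => koszul g X Y Z x) _ _ hX hZ

/-- The Levi-Civita connection of `g`. The value `leviCivita g Y x v` is `∇_v Y` at `x`. That it is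
torsion free and metric is shown in `leviCivita_torsion` and `leviCivita_metric`. -/
def leviCivita (g : RiemMetric I M) : CovariantDerivative I E (TangentSpace I : M → Type _) where
  toFun := leviCivitaFun g
  isCovariantDerivativeOnUniv :=
    { add := by
        intro Y Y' x hY hY' _
        ext1 u
        obtain ⟨X, hX, rfl⟩ : ∃ X : Π x : M, TangentSpace I x, MDiffAt (T% X) x ∧ X x = u :=
          ⟨FiberBundle.extend E u, FiberBundle.mdifferentiableAt_extend .., by simp⟩
        refine ext_of_inner_mdiff g fun Z hZ => ?_
        have hs : MDiffAt (T% (Y + Y')) x := mdifferentiableAt_add_section hY hY'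
        rw [add_apply, map_add, add_apply,
          inner_leviCivitaFun g hX hY hZ,
          inner_leviCivitaFun g hX hY' hZ, inner_leviCivitaFun g hX hs hZ]
        have e1 : (fun y => g.inner y ((Y + Y') y) (Z y)) =
          fun y => g.inner y (Y y) (Z y) + g.inner y (Y' y) (Z y) := by ext y; simp
        have e2 : (fun y => g.inner y (X y) ((Y + Y') y)) =
          fun y => g.inner y (X y) (Y y) + g.inner y (X y) (Y' y) := by ext y; simp
        simp only [koszul]
        rw [e1, e2, mvfderiv_fun_add (mdiff_inner g hY hZ) (mdiff_inner g hY' hZ),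
          mvfderiv_fun_add (mdiff_inner g hX hY) (mdiff_inner g hX hY'),
          VectorField.mlieBracket_add_left hY hY', VectorField.mlieBracket_add_right hY hY']
        simp
        ring
      leibniz := by
        intro Y f x hY hf _
        ext1 u
        obtain ⟨X, hX, rfl⟩ : ∃ X : Π x : M, TangentSpace I x, MDiffAt (T% X) x ∧ X x = u :=
          ⟨FiberBundle.extend E u, FiberBundle.mdifferentiableAt_extend .., by simp⟩
        refine ext_of_inner_mdiff g fun Z hZ => ?_
        have hs : MDiffAt (T% (f • Y)) x := hf.smul_section hY
        rw [add_apply, map_add, add_apply,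
          smul_apply, map_smul, smul_apply,
          inner_leviCivitaFun g hX hY hZ, inner_leviCivitaFun g hX hs hZ]
        have e1 : (fun y => g.inner y ((f • Y) y) (Z y)) =
          fun y => f y * g.inner y (Y y) (Z y) := by ext y; simp
        have e2 : (fun y => g.inner y (X y) ((f • Y) y)) =
          fun y => f y * g.inner y (X y) (Y y) := by ext y; simp
        simp only [koszul]
        rw [e1, e2, mvfderiv_fun_mul hf (mdiff_inner g hY hZ),
          mvfderiv_fun_mul hf (mdiff_inner g hX hY),
          VectorField.mlieBracket_smul_left hf hY, VectorField.mlieBracket_smul_right hf hY]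
        simp [g.symm x (Y x) (X x)]
        ring }

theorem leviCivita_torsion (g : RiemMetric I M) : (leviCivita g).torsion = 0 := by
  rw [CovariantDerivative.torsion_eq_zero_iff]
  intro X Y x hX hY
  refine ext_of_inner_mdiff g fun Z hZ => ?_
  change g.inner x (leviCivitaFun g Y x (X x) - leviCivitaFun g X x (Y x)) (Z x) = _
  rw [map_sub, sub_apply, inner_leviCivitaFun g hX hY hZ,
    inner_leviCivitaFun g hY hX hZ]
  have e (A B : Π x : M, TangentSpace I x) : (fun y => g.inner y (A y) (B y)) =
    fun y => g.inner y (B y) (A y) := by ext y; exact g.symm ..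
  simp only [koszul]
  rw [e Z X, e Z Y, e Y X, VectorField.mlieBracket_swap_apply (V := Y) (W := X),
    VectorField.mlieBracket_swap_apply (V := Z) (W := Y),
    VectorField.mlieBracket_swap_apply (V := X) (W := Z)]
  simp only [map_neg, neg_apply]
  ring

theorem leviCivita_metric (g : RiemMetric I M) {X Y Z : Π x : M, TangentSpace I x} {x : M}
    (hX : MDiffAt (T% X) x) (hY : MDiffAt (T% Y) x) (hZ : MDiffAt (T% Z) x) :
    mvfderiv I (fun y => g.inner y (Y y) (Z y)) x (X x) =
      g.inner x (leviCivita g Y x (X x)) (Z x) + g.inner x (Y x) (leviCivita g Z x (X x)) := by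
  change _ = g.inner x (leviCivitaFun g Y x (X x)) (Z x) +
    g.inner x (Y x) (leviCivitaFun g Z x (X x))
  rw [g.symm x (Y x), inner_leviCivitaFun g hX hY hZ, inner_leviCivitaFun g hX hZ hY]
  have e (A B : Π x : M, TangentSpace I x) : (fun y => g.inner y (A y) (B y)) =
    fun y => g.inner y (B y) (A y) := by ext y; exact g.symm ..
  simp only [koszul]
  rw [e Z X, e Z Y, e Y X, VectorField.mlieBracket_swap_apply (V := Y) (W := X),
    VectorField.mlieBracket_swap_apply (V := Z) (W := Y),
    VectorField.mlieBracket_swap_apply (V := X) (W := Z)]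
  simp only [map_neg, neg_apply]
  ring

section Constructions

theorem contMDiffAt_inner (g : RiemMetric I M) {E₀ : Type*} [NormedAddCommGroup E₀] [NormedSpace ℝ E₀]
    {H₀ : Type*} [TopologicalSpace H₀] {I₀ : ModelWithCorners ℝ E₀ H₀}
    {P : Type*} [TopologicalSpace P] [ChartedSpace H₀ P] {f : P → M}
    {X Y : Π p : P, TangentSpace I (f p)} {p : P}
    (hX : ContMDiffAt I₀ (I.prod 𝓘(ℝ, E)) ∞ (fun q => (⟨f q, X q⟩ : TangentBundle I M)) p)
    (hY : ContMDiffAt I₀ (I.prod 𝓘(ℝ, E)) ∞ (fun q => (⟨f q, Y q⟩ : TangentBundle I M)) p) :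
    ContMDiffAt I₀ 𝓘(ℝ) ∞ (fun q => g.inner (f q) (X q) (Y q)) p := by
  have hf : ContMDiffAt I₀ I ∞ f p := ((contMDiffAt_totalSpace).1 hX).1
  have h : ContMDiffAt I₀ (I.prod 𝓘(ℝ)) ∞ (fun q =>
      TotalSpace.mk' ℝ (E := Bundle.Trivial M ℝ) (f q) (g.inner (f q) (X q) (Y q))) p :=
    ContMDiffAt.clm_bundle_apply₂ (F₁ := E) (F₂ := E)
      (ContMDiffAt.comp p (g.contMDiff.contMDiffAt) hf) hX hY
  exact ((contMDiffAt_totalSpace).1 h).2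

theorem contMDiffAt_of_bilin_apply {P : Type*} [TopologicalSpace P] [ChartedSpace H P] {p : P}
    {B : P → E →L[ℝ] E →L[ℝ] ℝ} (h : ∀ v w, ContMDiffAt I 𝓘(ℝ) ∞ (fun q => B q v w) p) :
    ContMDiffAt I 𝓘(ℝ, E →L[ℝ] E →L[ℝ] ℝ) ∞ B p := by
  let b := Module.finBasis ℝ E
  let c (i) : E →L[ℝ] ℝ := LinearMap.toContinuousLinearMap (b.coord i)
  have key : B = fun q => ∑ i, ∑ j, (B q (b i) (b j)) • (c i).smulRight (c j) := by
    ext q v w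
    conv_lhs => rw [← b.sum_repr v, ← b.sum_repr w]
    simp only [map_sum, map_smul, sum_apply, smul_apply,
      ContinuousLinearMap.smulRight_apply, smul_eq_mul, c, LinearMap.coe_toContinuousLinearMap',
      Module.Basis.coord_apply, Finset.mul_sum]
    rw [Finset.sum_comm]
    refine Finset.sum_congr rfl fun i _ => Finset.sum_congr rfl fun j _ => ?_
    ring
  rw [key]
  refine ContMDiffAt.sum fun i _ => ContMDiffAt.sum fun j _ => ?_
  exact (h _ _).smul contMDiffAt_const

theorem contMDiff_bilin_section
    (s : Π x : M, TangentSpace I x →L[ℝ] TangentSpace I x →L[ℝ] ℝ)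
    (h : ∀ (X Y : Π x : M, TangentSpace I x) (x : M),
      ContMDiffAt I (I.prod 𝓘(ℝ, E)) ∞ (fun y => (⟨y, X y⟩ : TangentBundle I M)) x →
      ContMDiffAt I (I.prod 𝓘(ℝ, E)) ∞ (fun y => (⟨y, Y y⟩ : TangentBundle I M)) x →
      ContMDiffAt I 𝓘(ℝ) ∞ (fun y => s y (X y) (Y y)) x) :
    ContMDiff I (I.prod 𝓘(ℝ, E →L[ℝ] E →L[ℝ] ℝ)) ∞
      (fun x => TotalSpace.mk' (E →L[ℝ] E →L[ℝ] ℝ)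
        (E := fun x : M => TangentSpace I x →L[ℝ] TangentSpace I x →L[ℝ] ℝ) x (s x)) := by
  intro x₀
  rw [contMDiffAt_hom_bundle]
  refine ⟨contMDiffAt_id, contMDiffAt_of_bilin_apply fun v w => ?_⟩
  let e := trivializationAt E (TangentSpace I : M → Type _) x₀
  have hx₀ : x₀ ∈ e.baseSet := FiberBundle.mem_baseSet_trivializationAt' x₀
  have hs (u : E) : ContMDiffAt I (I.prod 𝓘(ℝ, E)) ∞
      (fun y => (⟨y, e.symm y u⟩ : TangentBundle I M)) x₀ := by
    have := FiberBundle.contMDiffAt_extend (I := I) (k := ∞) (F := E)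
      (V := (TangentSpace I : M → Type _)) (e.symm x₀ u)
    have he : (fun y => (⟨y, e.symm y u⟩ : TangentBundle I M)) =
        fun y => ⟨y, FiberBundle.extend E (e.symm x₀ u) y⟩ := by
      funext y
      simp only [FiberBundle.extend]
      rw [e.apply_mk_symm hx₀]
    rw [he]
    exact this
  refine (h _ _ x₀ (hs v) (hs w)).congr_of_eventuallyEq ?_
  filter_upwards [e.open_baseSet.mem_nhds hx₀] with y hy
  have := inCoordinates_apply_eq₂ (F₁ := E) (F₂ := E) (F₃ := ℝ) (𝕜 := ℝ)
    (E₁ := (TangentSpace I : M → Type _)) (E₂ := (TangentSpace I : M → Type _))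
    (E₃ := Bundle.Trivial M ℝ) (x₀ := x₀) (ϕ := s y) (v := v) (w := w) hy hy (Set.mem_univ _)
  refine this.trans ?_
  simp [e]

theorem isVonNBounded_of_pos {x : M} (B : TangentSpace I x →L[ℝ] TangentSpace I x →L[ℝ] ℝ)
    (hB : ∀ v, v ≠ 0 → 0 < B v v) :
    Bornology.IsVonNBounded ℝ {v : TangentSpace I x | B v v < 1} := by
  let B' : E →L[ℝ] E →L[ℝ] ℝ := B
  have hB' : ∀ v : E, v ≠ 0 → 0 < B' v v := hB
  change Bornology.IsVonNBounded ℝ {v : E | B' v v < 1}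
  rw [NormedSpace.isVonNBounded_iff]
  rcases subsingleton_or_nontrivial E with hE | hE
  · exact (Set.toFinite _).isBounded
  obtain ⟨u, hu, hmin⟩ := (isCompact_sphere (0 : E) 1).exists_isMinOn
    (NormedSpace.sphere_nonempty.2 zero_le_one)
    (f := fun v => B' v v)
    ((B'.continuous.clm_apply continuous_id).continuousOn)
  have hu1 : ‖u‖ = 1 := by simpa using hu
  have hm : 0 < B' u u := hB' u (by rintro rfl; simp at hu1)
  refine (Metric.isBounded_closedBall (x := (0 : E)) (r := 1 + 1 / B' u u)).subset fun v hv => ?_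
  rw [mem_closedBall_zero_iff]
  by_cases hv0 : v = 0
  · subst hv0; simp; positivity
  have hn : 0 < ‖v‖ := norm_pos_iff.2 hv0
  have h1 : B' u u ≤ B' (‖v‖⁻¹ • v) (‖v‖⁻¹ • v) := hmin (by simp [norm_smul, hn.ne'])
  have h2 : B' u u * ‖v‖ ^ 2 ≤ B' v v := by
    simp only [map_smul, smul_apply, smul_eq_mul] at h1
    calc B' u u * ‖v‖ ^ 2 ≤ (‖v‖⁻¹ * (‖v‖⁻¹ * B' v v)) * ‖v‖ ^ 2 := by gcongr
      _ = B' v v := by field_simp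
  have h3 : B' v v < 1 := hv
  have h4 : ‖v‖ ^ 2 < 1 / B' u u := by rw [lt_div_iff₀ hm]; linarith
  nlinarith [sq_nonneg (‖v‖ - 1)]

/-- A positive definite symmetric tensor whose values on smooth vector fields are smooth. -/
def RiemMetric.ofTensor (s : Π x : M, TangentSpace I x →L[ℝ] TangentSpace I x →L[ℝ] ℝ)
    (symm : ∀ x v w, s x v w = s x w v) (pos : ∀ x v, v ≠ 0 → 0 < s x v v)
    (h : ∀ (X Y : Π x : M, TangentSpace I x) (x : M),
      ContMDiffAt I (I.prod 𝓘(ℝ, E)) ∞ (fun y => (⟨y, X y⟩ : TangentBundle I M)) x →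
      ContMDiffAt I (I.prod 𝓘(ℝ, E)) ∞ (fun y => (⟨y, Y y⟩ : TangentBundle I M)) x →
      ContMDiffAt I 𝓘(ℝ) ∞ (fun y => s y (X y) (Y y)) x) : RiemMetric I M where
  inner := s
  symm := symm
  pos := pos
  isVonNBounded x := isVonNBounded_of_pos (s x) (pos x)
  contMDiff := contMDiff_bilin_section s h

/-- The metric `c g`. -/
def RiemMetric.scale (c : ℝ) (hc : 0 < c) (g : RiemMetric I M) : RiemMetric I M :=
  RiemMetric.ofTensor (fun x => c • g.inner x)
    (fun x v w => by simp [g.symm x v w])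
    (fun x v hv => by simpa using mul_pos hc (g.pos x v hv))
    (fun X Y x hX hY => by
      exact ContMDiffAt.mul (contMDiffAt_const (c := c)) (contMDiffAt_inner g hX hY))

variable {E' : Type*} [NormedAddCommGroup E'] [NormedSpace ℝ E'] [FiniteDimensional ℝ E']
  {H' : Type*} [TopologicalSpace H'] {J : ModelWithCorners ℝ E' H'}
  {N : Type*} [TopologicalSpace N] [ChartedSpace H' N] [IsManifold J ∞ N]

theorem contMDiffAt_pushforward {f : M → N} (hf : ContMDiff I J ∞ f)
    {X : Π x : M, TangentSpace I x} {x : M}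
    (hX : ContMDiffAt I (I.prod 𝓘(ℝ, E)) ∞ (fun y => (⟨y, X y⟩ : TangentBundle I M)) x) :
    ContMDiffAt I (J.prod 𝓘(ℝ, E')) ∞
      (fun y => (⟨f y, mfderiv I J f y (X y)⟩ : TangentBundle J N)) x :=
  ((hf.contMDiff_tangentMap (m := ∞) (by simp)).contMDiffAt).comp x hX

/-- The pull-back `f^* g`, that is, `(v, w) ↦ g (df v, df w)`. -/
def pullbackInner (g : RiemMetric J N) (f : M → N) (x : M) :
    TangentSpace I x →L[ℝ] TangentSpace I x →L[ℝ] ℝ :=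
  (ContinuousLinearMap.precomp ℝ (mfderiv I J f x)) ∘L (g.inner (f x)) ∘L (mfderiv I J f x)

theorem pullbackInner_apply (g : RiemMetric J N) (f : M → N) (x : M) (v w : TangentSpace I x) :
    pullbackInner g f x v w = g.inner (f x) (mfderiv I J f x v) (mfderiv I J f x w) := rfl

/-- The product metric `g ⊕ g'` on `M × N`. -/
def RiemMetric.prod (g : RiemMetric I M) (g' : RiemMetric J N) : RiemMetric (I.prod J) (M × N) :=
  RiemMetric.ofTensor
    (fun p => pullbackInner g Prod.fst p + pullbackInner g' Prod.snd p)
    (fun p v w => by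
      simp only [add_apply, pullbackInner_apply]
      rw [g.symm, g'.symm])
    (fun p v hv => by
      simp only [add_apply, pullbackInner_apply]
      have nn (u : TangentSpace I p.1) : 0 ≤ g.inner p.1 u u := by
        by_cases hu : u = 0
        · simp [hu]
        · exact (g.pos _ _ hu).le
      have nn' (u : TangentSpace J p.2) : 0 ≤ g'.inner p.2 u u := by
        by_cases hu : u = 0
        · simp [hu]
        · exact (g'.pos _ _ hu).le
      by_cases h1 : mfderiv (I.prod J) I Prod.fst p v = 0
      · have h2 : mfderiv (I.prod J) J Prod.snd p v ≠ 0 := by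
          intro h2
          rw [mfderiv_fst] at h1
          rw [mfderiv_snd] at h2
          exact hv (Prod.ext h1 h2)
        have := g'.pos p.2 _ h2
        have := nn (mfderiv (I.prod J) I Prod.fst p v)
        linarith
      · have := g.pos p.1 _ h1
        have := nn' (mfderiv (I.prod J) J Prod.snd p v)
        linarith)
    (fun X Y p hX hY => by
      simp only [add_apply, pullbackInner_apply]
      exact (contMDiffAt_inner g (contMDiffAt_pushforward contMDiff_fst hX)
        (contMDiffAt_pushforward contMDiff_fst hY)).add
        (contMDiffAt_inner g' (contMDiffAt_pushforward contMDiff_snd hX)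
        (contMDiffAt_pushforward contMDiff_snd hY)))

end Constructions

section Laplacian

/-- The vector field that is dual to a `1`-form. -/
def sharp (g : RiemMetric I M) (α : Π x : M, TangentSpace I x →L[ℝ] ℝ) (x : M) :
    TangentSpace I x :=
  (flat g x).symm (α x)

theorem inner_sharp (g : RiemMetric I M) (α : Π x : M, TangentSpace I x →L[ℝ] ℝ) (x : M)
    (v : TangentSpace I x) : g.inner x (sharp g α x) v = α x v := by
  change flat g x ((flat g x).symm (α x)) v = α x v
  rw [LinearEquiv.apply_symm_apply]

/-- The divergence of a vector field, the trace of `v ↦ ∇_v X`. -/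
def divergence (g : RiemMetric I M) (X : Π x : M, TangentSpace I x) (x : M) : ℝ :=
  LinearMap.trace ℝ (TangentSpace I x) (leviCivita g X x).toLinearMap

/-- The codifferential `δ` on `1`-forms, the formal adjoint of `d` on functions. -/
def codifferential (g : RiemMetric I M) (α : Π x : M, TangentSpace I x →L[ℝ] ℝ) (x : M) : ℝ :=
  - divergence g (sharp g α) x

/-- The Laplace-Beltrami operator `Δ = dδ + δd = δd` on real functions. -/
def laplacian (g : RiemMetric I M) (f : M → ℝ) (x : M) : ℝ :=
  codifferential g (mvfderiv I f) x

/-- The complex linear extension of the Laplace-Beltrami operator to complex functions. -/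
def complexLaplacian (g : RiemMetric I M) (φ : M → ℂ) (x : M) : ℂ :=
  (laplacian g (fun y => (φ y).re) x : ℂ) +
    Complex.I * (laplacian g (fun y => (φ y).im) x : ℂ)

/-- The space of smooth complex functions `φ` with `Δ φ = c φ`. -/
def eigenspace (g : RiemMetric I M) (c : ℝ) : Set (M → ℂ) :=
  {φ | ContMDiff I 𝓘(ℝ, ℂ) ∞ φ ∧ ∀ x, complexLaplacian g φ x = (c : ℂ) * φ x}

end Laplacian

section Submersion

variable {E' : Type*} [NormedAddCommGroup E'] [NormedSpace ℝ E'] [FiniteDimensional ℝ E']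
  {H' : Type*} [TopologicalSpace H'] {J : ModelWithCorners ℝ E' H'}
  {N : Type*} [TopologicalSpace N] [ChartedSpace H' N] [IsManifold J ∞ N]

variable (I J) in
/-- The vertical space at `x`, the kernel of the differential. -/
def vertical (f : M → N) (x : M) : Submodule ℝ (TangentSpace I x) :=
  LinearMap.ker (mfderiv I J f x).toLinearMap

variable (J) in
/-- The horizontal space at `x`, the orthogonal complement of the vertical space. -/
def horizontal (g : RiemMetric I M) (f : M → N) (x : M) : Submodule ℝ (TangentSpace I x) where
  carrier := {u | ∀ v ∈ vertical I J f x, g.inner x u v = 0}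
  add_mem' {u u'} hu hu' v hv := by
    rw [map_add, add_apply, hu v hv, hu' v hv, add_zero]
  zero_mem' v _ := by rw [map_zero, zero_apply]
  smul_mem' c u hu v hv := by
    rw [map_smul, smul_apply, hu v hv, smul_zero]

/-- A Riemannian submersion: a surjective smooth submersion whose differential maps each horizontal
space isometrically onto the tangent space of the base. -/
structure IsRiemannianSubmersion (g : RiemMetric I M) (g' : RiemMetric J N) (f : M → N) : Prop where
  smooth : ContMDiff I J ∞ f
  surjective : Function.Surjective f
  submersion : ∀ x, Function.Surjective (mfderiv I J f x)
  surjOn : ∀ x, Set.SurjOn (mfderiv I J f x) (horizontal J g f x) Set.univ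
  isometry : ∀ x, ∀ u ∈ horizontal J g f x, ∀ v ∈ horizontal J g f x,
    g'.inner (f x) (mfderiv I J f x u) (mfderiv I J f x v) = g.inner x u v

variable (J) in
/-- The fibers of a submersion `f` are totally geodesic, that is, their second fundamental form
vanishes: if a smooth vector field `Y` is tangent to the fiber over `b` at all points of that fiber,
then so is `∇_v Y` for every vector `v` tangent to that fiber. The tangent spaces of the fibers are
the vertical spaces. -/
def HasTotallyGeodesicFibers (g : RiemMetric I M) (f : M → N) : Prop :=
  ∀ (b : N) (Y : Π x : M, TangentSpace I x), IsSmoothVF Y →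
    (∀ y, f y = b → Y y ∈ vertical I J f y) →
    ∀ x, f x = b → ∀ v ∈ vertical I J f x, leviCivita g Y x v ∈ vertical I J f x

end Submersion

/-- A Riemannian metric on a Lie group is bi-invariant if all left and all right translations are
isometries. -/
structure IsBiInvariant {G : Type*} [TopologicalSpace G] [ChartedSpace H G] [Group G]
    [LieGroup I ∞ G] (g : RiemMetric I G) : Prop where
  left : ∀ (a x : G) (v w : TangentSpace I x),
    g.inner (a * x) (mfderiv I I (fun y => a * y) x v) (mfderiv I I (fun y => a * y) x w) =
      g.inner x v w
  right : ∀ (a x : G) (v w : TangentSpace I x),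
    g.inner (x * a) (mfderiv I I (fun y => y * a) x v) (mfderiv I I (fun y => y * a) x w) =
      g.inner x v w

end RiemGeom

end

/-!
The multiplication `m : G × G → G` has differential `(u, w) ↦ dR_y u + dL_x w` at `(x, y)`. Both
translations are isometries for a bi-invariant metric, so `(dR_y u, dL_x w)` are isometric
coordinates `(a, b)` on `T_{(x, y)} (G × G)`, in which `dm` is `a + b`, the metric is
`2 (|a|² + |b|²)`, and the horizontal vectors are those with `a = b` (`mem_horizontal_iff`). Since
`|a + a|² = 2 (|a|² + |a|²)`, the map `m` is a Riemannian submersion.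

The other two statements come from Killing fields. A left-invariant and a right-invariant field on
`G` commute: `(0, L)` and `(R, 0)` have bracket `0` on `G × G` and are `m`-related to `L` and `R`
(`mlieBracket_leftField_rightField`, `mfderiv_mlieBracket_of_related`). Hence each left-invariant
field preserves the inner products of a commuting frame of right-invariant fields, and conversely,
so that invariant fields of either kind are Killing fields, and so are the fields on `G × G` with
such components (`HasCommutingFrames.isKilling`). No flows are used: all is deduced from the
vanishing torsion and the metric compatibility of the Levi-Civita connection.

*Fibers.* The Killing fields `V_a = (L_a, R_{-a})` span the vertical spaces, and their inner
products are constant. Therefore `∇_{V_a} V_c + ∇_{V_c} V_a = 0`, while the difference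
`[V_a, V_c]` is vertical, so `∇_{V_a} V_c` is vertical (`mfderiv_mul_leviCivita`). A field `Y` that
is tangent to a fiber differs from some `V_c` by a field `U = ∑ hₛ eₛ` with `U p = 0`, where
`eₛ` is a frame of fields `(R, L)`. Each `dm eₛ` is constant on the fiber, so `dm (∇_v U)`
is the derivative along the fiber of `∑ hₛ dm eₛ = dm U = 0`
(`mfderiv_mul_leviCivita_of_eq_zero`).

*Laplacian.* Killing fields are divergence free, so an orthogonal frame of Killing fields of squared
length `c` gives `Δ f = - c⁻¹ ∑ eₛ (eₛ f)` (`IsKillingFrame.laplacian_eq`). On `G` this applies to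
the left-invariant and to the right-invariant frames, with `c = 1`, and on `G × G` to the fields
`(R_i, 0)` and `(0, L_i)`, with `c = 2`. As these are `m`-related to `R_i` and `L_i`, the Laplacian
of `f ∘ m` is half the sum of the two expressions for `Δ f`, taken at `m`
(`laplacian_comp_mul`).
-/

namespace RiemGeom

set_option linter.unusedSectionVars false

open VectorField

/-! ### Lie brackets as commutators, and related vector fields -/

section Bracket

variable {E : Type*} [NormedAddCommGroup E] [NormedSpace ℝ E] [FiniteDimensional ℝ E]
  {H : Type*} [TopologicalSpace H] {I : ModelWithCorners ℝ E H} [I.Boundaryless]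
  {M : Type*} [TopologicalSpace M] [ChartedSpace H M] [IsManifold I ∞ M]
  {E' : Type*} [NormedAddCommGroup E'] [NormedSpace ℝ E'] [FiniteDimensional ℝ E']
  {H' : Type*} [TopologicalSpace H'] {J : ModelWithCorners ℝ E' H'} [J.Boundaryless]
  {N : Type*} [TopologicalSpace N] [ChartedSpace H' N] [IsManifold J ∞ N]

theorem two_le_infty : (2 : ℕ∞ω) ≤ ∞ := WithTop.coe_le_coe.2 (le_top : (2 : ℕ∞) ≤ ⊤)

theorem mvfderiv_congr {f k : M → ℝ} {x : M} (h : f =ᶠ[nhds x] k) (v : TangentSpace I x) :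
    mvfderiv I f x v = mvfderiv I k x v :=
  congrArg (fun A : E →L[ℝ] ℝ => A v) (h.mfderiv_eq (I := I) (I' := 𝓘(ℝ)))

/-- The expression of a vector field in the preferred chart at `x`, as a map of the model space. -/
noncomputable def chartField (x : M) (V : Π x : M, TangentSpace I x) (z : E) : E :=
  mpullbackWithin 𝓘(ℝ, E) I (extChartAt I x).symm V (Set.range I) z

theorem differentiableAt_chartField {V : Π x : M, TangentSpace I x} {x : M}
    (hV : MDiffAt (T% V) x) : DifferentiableAt ℝ (chartField x V) (extChartAt I x x) := by
  have : IsManifold I 2 M :=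
    IsManifold.of_le (n := ∞) two_le_infty
  have h := (mdifferentiableWithinAt_univ.2 hV).differentiableWithinAt_mpullbackWithin_vectorField
  have e : (extChartAt I x).symm ⁻¹' Set.univ ∩ Set.range I = Set.univ := by
    rw [I.range_eq_univ]; simp
  rw [← differentiableWithinAt_univ, ← e]
  exact h

theorem mfderiv_extChartAt_apply_eq_chartField (V : Π x : M, TangentSpace I x) (x : M) :
    mfderiv I 𝓘(ℝ, E) (extChartAt I x) x (V x) = chartField x V (extChartAt I x x) := by
  have : IsManifold I 1 M := IsManifold.of_le (n := ∞) (by simp)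
  simp only [chartField, mpullbackWithin]
  rw [extChartAt_to_inv, mfderiv_extChartAt_self]
  exact (mfderivWithin_extChartAt_symm_inverse_apply (V x)).symm

theorem mfderivWithin_symm_chartField (V : Π x : M, TangentSpace I x) (x : M) {z : E}
    (hz : z ∈ (extChartAt I x).target) :
    mfderivWithin 𝓘(ℝ, E) I (extChartAt I x).symm (Set.range I) z (chartField (I := I) x V z : E) =
      V ((extChartAt I x).symm z) := by
  have : IsManifold I 1 M := IsManifold.of_le (n := ∞) (by simp)
  have h := isInvertible_mfderivWithin_extChartAt_symm (I := I) hz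
  exact h.self_apply_inverse _

/-- In the preferred chart at `x` the function `V f` is the ordinary directional derivative of the
expression of `f` along that of `V`. -/
theorem mvfderiv_apply_eventuallyEq {f : M → ℝ} {x : M} (hf : ContMDiffAt I 𝓘(ℝ) 2 f x)
    (V : Π x : M, TangentSpace I x) :
    (fun y => mvfderiv I f y (V y)) =ᶠ[nhds x]
      (fun z => fderiv ℝ (f ∘ (extChartAt I x).symm) z (chartField x V z)) ∘ extChartAt I x := by
  have h1 : ∀ᶠ y in nhds x, MDiffAt f y :=
    ((contMDiffAt_iff_contMDiffAt_nhds (by simp)).1 hf).mono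
      fun y hy => hy.mdifferentiableAt (by simp)
  have hr : Set.range I = Set.univ := I.range_eq_univ
  filter_upwards [h1, extChartAt_source_mem_nhds (I := I) x] with y hy hys
  have hz := (extChartAt I x).map_source hys
  have : IsManifold I 1 M := IsManifold.of_le (n := ∞) (by simp)
  have hd := mdifferentiableWithinAt_extChartAt_symm hz
  have hyy : (extChartAt I x).symm (extChartAt I x y) = y := (extChartAt I x).left_inv hys
  rw [← hyy] at hy
  have hc := mfderiv_comp_mfderivWithin (extChartAt I x y) hy hd
    (by rw [hr]; exact uniqueMDiffWithinAt_univ _)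
  have hc' := congrArg (fun A => A (chartField (I := I) x V (extChartAt I x y) : E)) hc
  have e : mfderiv I 𝓘(ℝ, ℝ) f ((extChartAt I x).symm (extChartAt I x y))
      (mfderivWithin 𝓘(ℝ, E) I (extChartAt I x).symm (Set.range I) (extChartAt I x y)
        (chartField (I := I) x V (extChartAt I x y) : E)) = mvfderiv I f y (V y) := by
    rw [mfderivWithin_symm_chartField V x hz, hyy]; rfl
  refine e.symm.trans (hc'.symm.trans ?_)
  rw [hr, mfderivWithin_univ, mfderiv_eq_fderiv]
  rfl

theorem contDiffAt_comp_extChartAt_symm {f : M → ℝ} {x : M} (hf : ContMDiffAt I 𝓘(ℝ) 2 f x) :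
    ContDiffAt ℝ 2 (f ∘ (extChartAt I x).symm) (extChartAt I x x) := by
  have h := (contMDiffAt_iff.1 hf).2
  rw [I.range_eq_univ, contDiffWithinAt_univ] at h
  exact h

theorem differentiableAt_fderiv_chartField {f : M → ℝ} {V : Π x : M, TangentSpace I x} {x : M}
    (hf : ContMDiffAt I 𝓘(ℝ) 2 f x) (hV : MDiffAt (T% V) x) :
    DifferentiableAt ℝ (fderiv ℝ (f ∘ (extChartAt I x).symm)) (extChartAt I x x) ∧
    DifferentiableAt ℝ (fun z => fderiv ℝ (f ∘ (extChartAt I x).symm) z (chartField x V z))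
      (extChartAt I x x) := by
  have h : DifferentiableAt ℝ (fderiv ℝ (f ∘ (extChartAt I x).symm)) (extChartAt I x x) :=
    ((contDiffAt_comp_extChartAt_symm hf).fderiv_right (m := 1) (by norm_num)).differentiableAt
      (by norm_num)
  exact ⟨h, h.clm_apply (differentiableAt_chartField hV)⟩

theorem mdiff_mvfderiv_apply {f : M → ℝ} {V : Π x : M, TangentSpace I x} {x : M}
    (hf : ContMDiffAt I 𝓘(ℝ) 2 f x) (hV : MDiffAt (T% V) x) :
    MDiffAt (fun y => mvfderiv I f y (V y)) x := by
  have : IsManifold I 1 M := IsManifold.of_le (n := ∞) (by simp)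
  refine MDifferentiableAt.congr_of_eventuallyEq ?_ (mvfderiv_apply_eventuallyEq hf V)
  exact (differentiableAt_fderiv_chartField hf hV).2.mdifferentiableAt.comp x
    (mdifferentiableAt_extChartAt (mem_chart_source H x))

/-- The iterated derivative `V (U f)` in the preferred chart. The first term is symmetric in `U` and
`V`, so only the second one contributes to the Lie bracket. -/
theorem mvfderiv_mvfderiv_apply {f : M → ℝ} {U : Π x : M, TangentSpace I x} {x : M}
    (hf : ContMDiffAt I 𝓘(ℝ) 2 f x) (hU : MDiffAt (T% U) x) (V : Π x : M, TangentSpace I x) :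
    mvfderiv I (fun y => mvfderiv I f y (U y)) x (V x) =
      fderiv ℝ (fderiv ℝ (f ∘ (extChartAt I x).symm)) (extChartAt I x x)
        (chartField x V (extChartAt I x x)) (chartField x U (extChartAt I x x)) +
      fderiv ℝ (f ∘ (extChartAt I x).symm) (extChartAt I x x)
        (fderiv ℝ (chartField x U) (extChartAt I x x) (chartField x V (extChartAt I x x))) := by
  have : IsManifold I 1 M := IsManifold.of_le (n := ∞) (by simp)
  obtain ⟨d2, dU⟩ := differentiableAt_fderiv_chartField hf hU
  have e : mvfderiv I (fun y => mvfderiv I f y (U y)) x (V x) =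
      mvfderiv I ((fun z => fderiv ℝ (f ∘ (extChartAt I x).symm) z (chartField x U z)) ∘
        extChartAt I x) x (V x) :=
    mvfderiv_congr (mvfderiv_apply_eventuallyEq hf U) _
  rw [e, mvfderiv_comp_apply x dU.mdifferentiableAt
    (mdifferentiableAt_extChartAt (mem_chart_source H x)), mfderiv_extChartAt_apply_eq_chartField]
  have e2 : mvfderiv 𝓘(ℝ, E) (fun z => fderiv ℝ (f ∘ (extChartAt I x).symm) z (chartField x U z))
      (extChartAt I x x) =
      fderiv ℝ (fun z => fderiv ℝ (f ∘ (extChartAt I x).symm) z (chartField x U z))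
      (extChartAt I x x) := mfderiv_eq_fderiv
  rw [e2, fderiv_clm_apply d2 (differentiableAt_chartField hU)]
  exact add_comm _ _

/-- The Lie bracket acts on functions as the commutator of directional derivatives. -/
theorem mvfderiv_mlieBracket {V W : Π x : M, TangentSpace I x} {f : M → ℝ} {x : M}
    (hf : ContMDiffAt I 𝓘(ℝ) 2 f x) (hV : MDiffAt (T% V) x) (hW : MDiffAt (T% W) x) :
    mvfderiv I f x (mlieBracket I V W x) =
      mvfderiv I (fun y => mvfderiv I f y (W y)) x (V x)
        - mvfderiv I (fun y => mvfderiv I f y (V y)) x (W x) := by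
  have h0 : mvfderiv I f x (mlieBracket I V W x) = _ :=
    (mvfderiv_apply_eventuallyEq hf (mlieBracket I V W)).self_of_nhds
  rw [mvfderiv_mvfderiv_apply hf hW, mvfderiv_mvfderiv_apply hf hV, h0]
  have hs := ((contDiffAt_comp_extChartAt_symm hf).isSymmSndFDerivAt (by simp)).eq
    (chartField x V (extChartAt I x x)) (chartField x W (extChartAt I x x))
  have hb : chartField x (mlieBracket I V W) (extChartAt I x x) =
      lieBracket ℝ (chartField x V) (chartField x W) (extChartAt I x x) := by
    have : IsManifold I 1 M := IsManifold.of_le (n := ∞) (by simp)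
    have e : (extChartAt I x).symm ⁻¹' Set.univ ∩ Set.range I = Set.univ := by
      rw [I.range_eq_univ]; simp
    rw [← mfderiv_extChartAt_apply_eq_chartField, ← mlieBracketWithin_univ,
      mlieBracketWithin_apply, e, ← lieBracketWithin_univ]
    exact (isInvertible_mfderiv_extChartAt (mem_extChartAt_source x)).self_apply_inverse _
  simp only [Function.comp_apply, hb, lieBracket, map_sub, hs]
  abel

/-- Two tangent vectors on which all smooth functions have the same derivative agree. -/
theorem eq_of_forall_mvfderiv_eq {x : M} {v w : TangentSpace I x}
    (h : ∀ f : M → ℝ, ContMDiffAt I 𝓘(ℝ) ∞ f x → mvfderiv I f x v = mvfderiv I f x w) : v = w := by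
  have : IsManifold I 1 M := IsManifold.of_le (n := ∞) (by simp)
  refine (SeparatingDual.eq_iff_forall_dual_eq (R := ℝ) (V := E)).2 fun l => ?_
  have hφ : MDiffAt (extChartAt I x) x := mdifferentiableAt_extChartAt (mem_chart_source H x)
  have hl : ∀ u : TangentSpace I x, mvfderiv I (l ∘ extChartAt I x) x u = l u := fun u => by
    rw [mvfderiv_comp_apply x l.differentiableAt.mdifferentiableAt hφ, mfderiv_extChartAt_self]
    exact congrArg (fun A : E →L[ℝ] ℝ => A u) (mfderiv_eq_fderiv.trans l.fderiv)
  rw [← hl v, ← hl w]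
  exact h _ (l.contDiff.contMDiff.contMDiffAt.comp x contMDiffAt_extChartAt)

/-- The brackets of `f`-related vector fields are `f`-related. -/
theorem mfderiv_mlieBracket_of_related {f : M → N} (hf : ContMDiff I J ∞ f)
    {V W : Π x : M, TangentSpace I x} {V' W' : Π x : N, TangentSpace J x} {x : M}
    (hV : MDiffAt (T% V) x) (hW : MDiffAt (T% W) x)
    (hV' : MDiffAt (T% V') (f x)) (hW' : MDiffAt (T% W') (f x))
    (eV : ∀ y, mfderiv I J f y (V y) = V' (f y)) (eW : ∀ y, mfderiv I J f y (W y) = W' (f y)) :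
    mfderiv I J f x (mlieBracket I V W x) = mlieBracket J V' W' (f x) := by
  refine eq_of_forall_mvfderiv_eq fun k hk => ?_
  have hk2 : ContMDiffAt J 𝓘(ℝ) 2 k (f x) := hk.of_le two_le_infty
  have hf2 : ContMDiff I J 2 f := hf.of_le two_le_infty
  have df : ∀ y, MDiffAt f y := fun y => hf.mdifferentiableAt (by simp)
  have dk : ∀ᶠ y in nhds x, MDiffAt k (f y) :=
    hf.continuous.continuousAt.eventually (((contMDiffAt_iff_contMDiffAt_nhds (by simp)).1 hk2).mono
      fun y hy => hy.mdifferentiableAt (by simp))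
  have push : ∀ (U : Π x : M, TangentSpace I x) (U' : Π x : N, TangentSpace J x),
      (∀ y, mfderiv I J f y (U y) = U' (f y)) → (fun y => mvfderiv I (k ∘ f) y (U y)) =ᶠ[nhds x]
        (fun z => mvfderiv J k z (U' z)) ∘ f := fun U U' e => by
    filter_upwards [dk] with y hy
    rw [mvfderiv_comp_apply y hy (df y), e]; rfl
  have push2 : ∀ (U : Π x : M, TangentSpace I x) (U' : Π x : N, TangentSpace J x),
      (∀ y, mfderiv I J f y (U y) = U' (f y)) → MDiffAt (T% U') (f x) →
       ∀ v, mvfderiv I (fun y => mvfderiv I (k ∘ f) y (U y)) x v =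
        mvfderiv J (fun z => mvfderiv J k z (U' z)) (f x) (mfderiv I J f x v) :=
      fun U U' e hU' v => by
    rw [← mvfderiv_comp_apply x (mdiff_mvfderiv_apply hk2 hU') (df x)]
    exact mvfderiv_congr (push U U' e) v
  rw [← mvfderiv_comp_apply x (hk.mdifferentiableAt (by simp)) (df x), mvfderiv_mlieBracket
    (hk2.comp x hf2.contMDiffAt) hV hW, mvfderiv_mlieBracket hk2 hV' hW', push2 W W' eW hW',
    push2 V V' eV hV', eV, eW]

end Bracket

/-! ### Product fields and invariant fields on a Lie group -/

section ProductFields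

variable {E : Type*} [NormedAddCommGroup E] [NormedSpace ℝ E] [FiniteDimensional ℝ E]
  {H : Type*} [TopologicalSpace H] {I : ModelWithCorners ℝ E H} [I.Boundaryless]
  {M : Type*} [TopologicalSpace M] [ChartedSpace H M] [IsManifold I ∞ M]
  {E' : Type*} [NormedAddCommGroup E'] [NormedSpace ℝ E'] [FiniteDimensional ℝ E']
  {H' : Type*} [TopologicalSpace H'] {J : ModelWithCorners ℝ E' H'} [J.Boundaryless]
  {N : Type*} [TopologicalSpace N] [ChartedSpace H' N] [IsManifold J ∞ N]

theorem IsSmoothVF.mdifferentiableAt {X : Π x : M, TangentSpace I x} (hX : IsSmoothVF X) (x : M) :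
    MDiffAt (T% X) x :=
  ContMDiff.mdifferentiableAt (n := ∞) hX (by simp)

theorem isSmoothVF_zero : IsSmoothVF (0 : Π x : M, TangentSpace I x) :=
  contMDiff_zeroSection _ _

/-- The vector field on a product whose components are vector fields on the two factors. -/
def prodField (X : Π x : M, TangentSpace I x) (Y : Π y : N, TangentSpace J y) (p : M × N) :
    TangentSpace (I.prod J) p :=
  (X p.1, Y p.2)

theorem IsSmoothVF.prodField {X : Π x : M, TangentSpace I x} {Y : Π y : N, TangentSpace J y}
    (hX : IsSmoothVF X) (hY : IsSmoothVF Y) : IsSmoothVF (I := I.prod J) (prodField X Y) :=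
  (contMDiff_equivTangentBundleProd_symm (I := I) (I' := J) (M := M) (M' := N)).comp
    ((hX.comp contMDiff_fst).prodMk (hY.comp contMDiff_snd))

theorem mfderiv_fst_prodField (X : Π x : M, TangentSpace I x) (Y : Π y : N, TangentSpace J y)
    (p : M × N) : mfderiv (I.prod J) I Prod.fst p (prodField X Y p) = X p.1 := by
  rw [mfderiv_fst]; rfl

theorem mfderiv_snd_prodField (X : Π x : M, TangentSpace I x) (Y : Π y : N, TangentSpace J y)
    (p : M × N) : mfderiv (I.prod J) J Prod.snd p (prodField X Y p) = Y p.2 := by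
  rw [mfderiv_snd]; rfl

theorem mlieBracket_prodField {X X' : Π x : M, TangentSpace I x} {Y Y' : Π y : N, TangentSpace J y}
    (hX : IsSmoothVF X) (hX' : IsSmoothVF X') (hY : IsSmoothVF Y) (hY' : IsSmoothVF Y') :
    mlieBracket (I.prod J) (prodField X Y) (prodField X' Y') =
      prodField (mlieBracket I X X') (mlieBracket J Y Y') := by
  funext p
  have h1 := mfderiv_mlieBracket_of_related (contMDiff_fst (I := I) (J := J) (M := M) (N := N))
    ((hX.prodField hY).mdifferentiableAt p) ((hX'.prodField hY').mdifferentiableAt p)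
    (hX.mdifferentiableAt p.1) (hX'.mdifferentiableAt p.1)
    (mfderiv_fst_prodField X Y) (mfderiv_fst_prodField X' Y')
  have h2 := mfderiv_mlieBracket_of_related (contMDiff_snd (I := I) (J := J) (M := M) (N := N))
    ((hX.prodField hY).mdifferentiableAt p) ((hX'.prodField hY').mdifferentiableAt p)
    (hY.mdifferentiableAt p.2) (hY'.mdifferentiableAt p.2)
    (mfderiv_snd_prodField X Y) (mfderiv_snd_prodField X' Y')
  rw [mfderiv_fst] at h1
  rw [mfderiv_snd] at h2
  exact Prod.ext h1 h2

end ProductFields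

section InvariantFields

variable {E : Type*} [NormedAddCommGroup E] [NormedSpace ℝ E] [FiniteDimensional ℝ E]
  {H : Type*} [TopologicalSpace H] {I : ModelWithCorners ℝ E H} [I.Boundaryless]
  {G : Type*} [TopologicalSpace G] [ChartedSpace H G] [Group G] [LieGroup I ∞ G]

variable (I) in
/-- The differential of the right translation by `y`. -/
noncomputable def dRight (y x : G) : TangentSpace I x →L[ℝ] TangentSpace I (x * y) :=
  mfderiv I I (fun z => z * y) x

variable (I) in
/-- The differential of the left translation by `x`. -/
noncomputable def dLeft (x y : G) : TangentSpace I y →L[ℝ] TangentSpace I (x * y) :=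
  mfderiv I I (fun z => x * z) y

theorem mfderiv_mul (p : G × G) (U : TangentSpace (I.prod I) p) :
    mfderiv (I.prod I) I (fun q : G × G => q.1 * q.2) p U =
      dRight I p.2 p.1 (mfderiv (I.prod I) I Prod.fst p U) +
      dLeft I p.1 p.2 (mfderiv (I.prod I) I Prod.snd p U) := by
  rw [mfderiv_fst, mfderiv_snd]
  exact mfderiv_prod_eq_add_apply ((contMDiff_mul I ∞).mdifferentiableAt (by simp))

theorem dRight_dRight (x y z : G) (v : TangentSpace I x) :
    dRight I z (x * y) (dRight I y x v) = dRight I (y * z) x v := by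
  have h := mfderiv_comp_apply (I := I) (I' := I) (I'' := I) x
    (g := fun w : G => w * z) (f := fun w : G => w * y)
    ((contMDiff_mul_right (I := I) (n := ∞)).mdifferentiableAt (by simp))
    ((contMDiff_mul_right (I := I) (n := ∞)).mdifferentiableAt (by simp)) v
  refine h.symm.trans ?_
  have e : (fun w : G => w * z) ∘ (fun w : G => w * y) = fun w => w * (y * z) := by
    funext w; simp [mul_assoc]
  rw [e]; rfl

theorem dLeft_dLeft (x y z : G) (v : TangentSpace I x) :
    dLeft I z (y * x) (dLeft I y x v) = dLeft I (z * y) x v := by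
  have h := mfderiv_comp_apply (I := I) (I' := I) (I'' := I) x
    (g := fun w : G => z * w) (f := fun w : G => y * w)
    ((contMDiff_mul_left (I := I) (n := ∞)).mdifferentiableAt (by simp))
    ((contMDiff_mul_left (I := I) (n := ∞)).mdifferentiableAt (by simp)) v
  refine h.symm.trans ?_
  have e : (fun w : G => z * w) ∘ (fun w : G => y * w) = fun w => (z * y) * w := by
    funext w; simp [mul_assoc]
  rw [e]; rfl

theorem dLeft_dRight (x y z : G) (v : TangentSpace I y) :
    dLeft I x (y * z) (dRight I z y v) = dRight I z (x * y) (dLeft I x y v) := by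
  have h := mfderiv_comp_apply (I := I) (I' := I) (I'' := I) y
    (g := fun w : G => x * w) (f := fun w : G => w * z)
    ((contMDiff_mul_left (I := I) (n := ∞)).mdifferentiableAt (by simp))
    ((contMDiff_mul_right (I := I) (n := ∞)).mdifferentiableAt (by simp)) v
  have h' := mfderiv_comp_apply (I := I) (I' := I) (I'' := I) y
    (g := fun w : G => w * z) (f := fun w : G => x * w)
    ((contMDiff_mul_right (I := I) (n := ∞)).mdifferentiableAt (by simp))
    ((contMDiff_mul_left (I := I) (n := ∞)).mdifferentiableAt (by simp)) v
  refine h.symm.trans (Eq.trans ?_ h')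
  have e : (fun w : G => x * w) ∘ (fun w : G => w * z) = (fun w => w * z) ∘ (fun w => x * w) := by
    funext w; simp [mul_assoc]
  rw [e]

/-- The left-invariant vector field with the value `v` at the identity. -/
noncomputable def leftField (v : TangentSpace I (1 : G)) (x : G) : TangentSpace I x :=
  dLeft I x 1 v

/-- The right-invariant vector field with the value `v` at the identity. -/
noncomputable def rightField (v : TangentSpace I (1 : G)) (x : G) : TangentSpace I x :=
  dRight I x 1 v

theorem dLeft_leftField (x y : G) (v : TangentSpace I (1 : G)) :
    dLeft I x y (leftField v y) = leftField v (x * y) := by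
  have h := dLeft_dLeft 1 y x v
  have key : ∀ z : G, z = y → ∀ w : E, (dLeft I x z w : E) = dLeft I x y w := by
    rintro z rfl w; rfl
  -- The base points `y * 1` and `y` are only propositionally equal.
  exact (key (y * 1) (mul_one y) _).symm.trans h

theorem dRight_rightField (x y : G) (v : TangentSpace I (1 : G)) :
    dRight I y x (rightField v x) = rightField v (x * y) := by
  have h := dRight_dRight 1 x y v
  have key : ∀ z : G, z = x → ∀ w : E, (dRight I y z w : E) = dRight I y x w := by
    rintro z rfl w; rfl
  exact (key (1 * x) (one_mul x) _).symm.trans h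

theorem mfderiv_mul_prodField (X Y : Π x : G, TangentSpace I x) (p : G × G) :
    mfderiv (I.prod I) I (fun q : G × G => q.1 * q.2) p (prodField X Y p) =
      dRight I p.2 p.1 (X p.1) + dLeft I p.1 p.2 (Y p.2) := by
  rw [mfderiv_mul, mfderiv_fst_prodField, mfderiv_snd_prodField]

/-- The differential of the multiplication depends smoothly on base points and vectors. The vectors
are typed in the model space `E`, so that constant ones can be used. -/
theorem contMDiff_mfderiv_mul {a b : G → G} {X Y : G → E}
    (hX : ContMDiff I I.tangent ∞ (fun x => (⟨a x, X x⟩ : TangentBundle I G)))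
    (hY : ContMDiff I I.tangent ∞ (fun x => (⟨b x, Y x⟩ : TangentBundle I G))) :
    ContMDiff I I.tangent ∞ (fun x => (⟨a x * b x,
      (dRight I (b x) (a x) (X x) : E) + (dLeft I (a x) (b x) (Y x) : E)⟩ : TangentBundle I G)) := by
  have h := ((contMDiff_mul I ∞ (G := G)).contMDiff_tangentMap (m := ∞) (by simp)).comp
    ((contMDiff_equivTangentBundleProd_symm (I := I) (I' := I) (M := G) (M' := G)).comp
      (hX.prodMk hY))
  have e : (fun x => (⟨a x * b x,
      (dRight I (b x) (a x) (X x) : E) + (dLeft I (a x) (b x) (Y x) : E)⟩ : TangentBundle I G)) =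
    tangentMap (I.prod I) I (fun q : G × G => q.1 * q.2) ∘
      (equivTangentBundleProd I G I G).symm ∘ fun x => (⟨a x, X x⟩, ⟨b x, Y x⟩) := by
    funext x
    have := mfderiv_mul (I := I) (a x, b x) (X x, Y x)
    rw [mfderiv_fst, mfderiv_snd] at this
    exact congrArg (fun w : E => (⟨a x * b x, w⟩ : TangentBundle I G)) this.symm
  rw [e]
  exact h

theorem isSmoothVF_leftField (v : TangentSpace I (1 : G)) : IsSmoothVF (leftField (I := I) v) := by
  have h := contMDiff_mfderiv_mul (I := I) (a := fun x : G => x) (b := fun _ => 1) (X := fun _ => 0)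
    (Y := fun _ => v) isSmoothVF_zero contMDiff_const
  have e : (fun x : G => (⟨x, leftField v x⟩ : TangentBundle I G)) = fun x => ⟨x * 1,
      (dRight I 1 x (0 : E) : E) + (dLeft I x 1 v : E)⟩ := by
    funext x
    have key : ∀ z : G, z = x → ∀ w w' : E, w = w' →
      (⟨x, w⟩ : TangentBundle I G) = ⟨z, w'⟩ := by
      rintro z rfl w w' rfl; rfl
    refine key _ (mul_one x) _ _ ?_
    have : (dRight I 1 x (0 : E) : E) = 0 := map_zero (dRight I 1 x)
    rw [this, zero_add]; rfl
  unfold IsSmoothVF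
  rw [e]
  exact h

theorem isSmoothVF_rightField (v : TangentSpace I (1 : G)) :
    IsSmoothVF (rightField (I := I) v) := by
  have h := contMDiff_mfderiv_mul (I := I) (a := fun _ : G => 1) (b := fun x => x) (X := fun _ => v)
    (Y := fun _ => 0) contMDiff_const isSmoothVF_zero
  have e : (fun x : G => (⟨x, rightField v x⟩ : TangentBundle I G)) = fun x => ⟨1 * x,
      (dRight I x 1 v : E) + (dLeft I 1 x (0 : E) : E)⟩ := by
    funext x
    have key : ∀ z : G, z = x → ∀ w w' : E, w = w' →
      (⟨x, w⟩ : TangentBundle I G) = ⟨z, w'⟩ := by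
      rintro z rfl w w' rfl; rfl
    refine key _ (one_mul x) _ _ ?_
    have : (dLeft I 1 x (0 : E) : E) = 0 := map_zero (dLeft I 1 x)
    rw [this, add_zero]; rfl
  unfold IsSmoothVF
  rw [e]
  exact h

/-- Left-invariant and right-invariant fields commute, since they are related by the multiplication
to the fields `(0, L)` and `(R, 0)` on `G × G`. -/
theorem mlieBracket_leftField_rightField (v w : TangentSpace I (1 : G)) :
    mlieBracket I (leftField (I := I) v) (rightField w) = 0 := by
  funext x
  have h := mfderiv_mlieBracket_of_related (contMDiff_mul I ∞ (G := G)) (x := ((1 : G), x))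
    (V := prodField 0 (leftField v)) (W := prodField (rightField w) 0)
    ((isSmoothVF_zero.prodField (isSmoothVF_leftField v)).mdifferentiableAt _)
    (((isSmoothVF_rightField w).prodField isSmoothVF_zero).mdifferentiableAt _)
    ((isSmoothVF_leftField v).mdifferentiableAt _)
    ((isSmoothVF_rightField w).mdifferentiableAt _)
    (fun y => by rw [mfderiv_mul_prodField, dLeft_leftField]; simp)
    (fun y => by rw [mfderiv_mul_prodField, dRight_rightField]; simp)
  rw [mlieBracket_prodField isSmoothVF_zero (isSmoothVF_rightField w) (isSmoothVF_leftField v)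
    isSmoothVF_zero, mlieBracket_zero_left, mlieBracket_zero_right, mfderiv_mul_prodField] at h
  have key : ∀ z : G, z = x → mlieBracket I (leftField (I := I) v) (rightField w) z = 0 →
    mlieBracket I (leftField (I := I) v) (rightField w) x = 0 := by
    rintro z rfl h; exact h
  exact key (1 * x) (one_mul x) (by rw [← h]; simp)

end InvariantFields

/-! ### Killing fields, Killing frames and the Laplacian -/

section Killing

variable {E : Type*} [NormedAddCommGroup E] [NormedSpace ℝ E] [FiniteDimensional ℝ E]
  {H : Type*} [TopologicalSpace H] {I : ModelWithCorners ℝ E H} [I.Boundaryless]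
  {M : Type*} [TopologicalSpace M] [ChartedSpace H M] [IsManifold I ∞ M]

theorem leviCivita_sub_leviCivita (g : RiemMetric I M) {X Y : Π x : M, TangentSpace I x}
    (hX : IsSmoothVF X) (hY : IsSmoothVF Y) (x : M) :
    leviCivita g Y x (X x) - leviCivita g X x (Y x) = mlieBracket I X Y x :=
  (leviCivita g).torsion_eq_zero_iff.1 (leviCivita_torsion g) (hX.mdifferentiableAt x)
    (hY.mdifferentiableAt x)

theorem leviCivita_add (g : RiemMetric I M) {X Y : Π x : M, TangentSpace I x} {x : M}
    (hX : MDiffAt (T% X) x) (hY : MDiffAt (T% Y) x) :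
    leviCivita g (X + Y) x = leviCivita g X x + leviCivita g Y x :=
  (leviCivita g).isCovariantDerivativeOnUniv.add hX hY

theorem leviCivita_smul (g : RiemMetric I M) {f : M → ℝ} {X : Π x : M, TangentSpace I x} {x : M}
    (hf : MDiffAt f x) (hX : MDiffAt (T% X) x) :
    leviCivita g (f • X) x = f x • leviCivita g X x + (mvfderiv I f x).smulRight (X x) :=
  (leviCivita g).isCovariantDerivativeOnUniv.leibniz hX hf

theorem mdiff_sum_smul {ι : Type*} (s : Finset ι) {f : ι → M → ℝ}
    {e : ι → Π x : M, TangentSpace I x} {x : M} (hf : ∀ i, MDiffAt (f i) x)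
    (he : ∀ i, MDiffAt (T% (e i)) x) : MDiffAt (T% (∑ i ∈ s, f i • e i)) x := by
  have h := MDifferentiableAt.sum_section (s := s) (fun i _ => (hf i).smul_section (he i))
  convert! h using 2 with y
  simp

theorem leviCivita_sum_smul (g : RiemMetric I M) {ι : Type*} (s : Finset ι) {f : ι → M → ℝ}
    {e : ι → Π x : M, TangentSpace I x} {x : M} (hf : ∀ i, MDiffAt (f i) x)
    (he : ∀ i, MDiffAt (T% (e i)) x) :
    leviCivita g (∑ i ∈ s, f i • e i) x =
      ∑ i ∈ s, (f i x • leviCivita g (e i) x + (mvfderiv I (f i) x).smulRight (e i x)) := by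
  classical
  induction s using Finset.induction_on with
  | empty => simp
  | insert a s ha ih =>
    rw [Finset.sum_insert ha, Finset.sum_insert ha, leviCivita_add g ((hf a).smul_section (he a))
      (mdiff_sum_smul s hf he), ih, leviCivita_smul g (hf a) (he a)]

/-- A smooth vector field `X` is a Killing field if `∇ X` is skew-symmetric. -/
structure IsKilling (g : RiemMetric I M) (X : Π x : M, TangentSpace I x) : Prop where
  smooth : IsSmoothVF X
  skew : ∀ x (v w : TangentSpace I x),
    g.inner x (leviCivita g X x v) w + g.inner x v (leviCivita g X x w) = 0

/-- A criterion for a Killing field: through any two tangent vectors at a point there are smooth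
fields `A`, `B` that commute with `X` at that point and for which the derivative of `g (A, B)` along
`X` vanishes there. Then the Lie derivative of `g` along `X` is zero, as it is a tensor. -/
structure HasCommutingFrames (g : RiemMetric I M) (X : Π x : M, TangentSpace I x) : Prop where
  smooth : IsSmoothVF X
  exists_fields : ∀ x (v w : TangentSpace I x), ∃ A B : Π x : M, TangentSpace I x,
    IsSmoothVF A ∧ IsSmoothVF B ∧ A x = v ∧ B x = w ∧
    mlieBracket I X A x = 0 ∧ mlieBracket I X B x = 0 ∧
    mvfderiv I (fun y => g.inner y (A y) (B y)) x (X x) = 0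

theorem HasCommutingFrames.isKilling {g : RiemMetric I M} {X : Π x : M, TangentSpace I x}
    (hX : HasCommutingFrames g X) : IsKilling g X := by
  refine ⟨hX.smooth, fun x v w => ?_⟩
  obtain ⟨A, B, hA, hB, rfl, rfl, cA, cB, hAB⟩ := hX.exists_fields x v w
  have tA := leviCivita_sub_leviCivita g hX.smooth hA x
  have tB := leviCivita_sub_leviCivita g hX.smooth hB x
  rw [cA, sub_eq_zero] at tA
  rw [cB, sub_eq_zero] at tB
  rw [← tA, ← tB, ← leviCivita_metric g (hX.smooth.mdifferentiableAt x) (hA.mdifferentiableAt x)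
    (hB.mdifferentiableAt x), hAB]

theorem IsKilling.add {g : RiemMetric I M} {X Y : Π x : M, TangentSpace I x}
    (hX : IsKilling g X) (hY : IsKilling g Y) : IsKilling g (X + Y) := by
  refine ⟨fun x => ContMDiffAt.add_section (hX.smooth x) (hY.smooth x), fun x v w => ?_⟩
  rw [leviCivita_add g (hX.smooth.mdifferentiableAt x) (hY.smooth.mdifferentiableAt x)]
  have h1 := hX.skew x v w
  have h2 := hY.skew x v w
  simp only [add_apply, map_add]
  linarith

/-- The integral curves of a Killing field of constant length are geodesics. -/
theorem IsKilling.leviCivita_self {g : RiemMetric I M} {X : Π x : M, TangentSpace I x}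
    (hX : IsKilling g X) (hc : ∀ x y, g.inner x (X x) (X x) = g.inner y (X y) (X y)) (x : M) :
    leviCivita g X x (X x) = 0 := by
  refine ext_of_inner_mdiff g fun Z hZ => ?_
  have h1 := hX.skew x (X x) (Z x)
  have dX := hX.smooth.mdifferentiableAt x
  have h2 := leviCivita_metric g hZ dX dX
  have h3 : (fun y => g.inner y (X y) (X y)) = fun _ => g.inner x (X x) (X x) :=
    funext fun y => hc y x
  rw [h3, mvfderiv_const, g.symm x (leviCivita g X x (Z x))] at h2
  simp only [zero_apply] at h2
  simp only [map_zero, zero_apply]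
  linarith

/-- Polarized form of `IsKilling.leviCivita_self`. -/
theorem leviCivita_add_leviCivita_of_isKilling {g : RiemMetric I M}
    {X Y : Π x : M, TangentSpace I x} (hX : IsKilling g X) (hY : IsKilling g Y)
    (hXX : ∀ x y, g.inner x (X x) (X x) = g.inner y (X y) (X y))
    (hYY : ∀ x y, g.inner x (Y x) (Y x) = g.inner y (Y y) (Y y))
    (hXY : ∀ x y, g.inner x (X x) (Y x) = g.inner y (X y) (Y y)) (x : M) :
    leviCivita g Y x (X x) + leviCivita g X x (Y x) = 0 := by
  have h := (hX.add hY).leviCivita_self (fun x y => by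
    have e1 := hXX x y
    have e2 := hYY x y
    have e3 := hXY x y
    simp only [Pi.add_apply, map_add, add_apply]
    rw [g.symm x (Y x) (X x), g.symm y (Y y) (X y)]
    linarith) x
  rw [leviCivita_add g (hX.smooth.mdifferentiableAt x) (hY.smooth.mdifferentiableAt x)] at h
  simp only [Pi.add_apply, map_add, add_apply] at h
  rw [hX.leviCivita_self hXX, hY.leviCivita_self hYY, zero_add, add_zero] at h
  exact h

/-- A frame of Killing fields that are pairwise orthogonal and have constant length `√c`. -/
structure IsKillingFrame {ι : Type*} [Fintype ι] (g : RiemMetric I M) (c : ℝ)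
    (e : ι → Π x : M, TangentSpace I x) : Prop where
  pos : 0 < c
  isKilling : ∀ i, IsKilling g (e i)
  inner_self : ∀ i x, g.inner x (e i x) (e i x) = c
  inner_ne : ∀ i j, i ≠ j → ∀ x, g.inner x (e i x) (e j x) = 0
  card_eq : Fintype.card ι = Module.finrank ℝ E

section Frame

variable {ι : Type*} [Fintype ι] {g : RiemMetric I M} {c : ℝ} {e : ι → Π x : M, TangentSpace I x}

theorem IsKillingFrame.inner_sum (he : IsKillingFrame g c e) (x : M) (a : ι → ℝ) (j : ι) :
    g.inner x (∑ i, a i • e i x) (e j x) = a j * c := by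
  rw [map_sum, sum_apply, Finset.sum_eq_single j]
  · rw [map_smul, smul_apply, he.inner_self, smul_eq_mul]
  · intro i _ hi
    rw [map_smul, smul_apply, he.inner_ne i j hi, smul_zero]
  · simp

/-- The expansion of a tangent vector in a Killing frame. -/
theorem IsKillingFrame.eq_sum (he : IsKillingFrame g c e) (x : M) (u : TangentSpace I x) :
    u = ∑ i, (c⁻¹ * g.inner x u (e i x)) • e i x := by
  have hc := he.pos.ne'
  have hli : LinearIndependent ℝ (fun i => e i x) := by
    refine Fintype.linearIndependent_iff.2 fun a ha j => ?_
    have h := he.inner_sum x a j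
    rw [ha, map_zero, zero_apply] at h
    exact (mul_eq_zero.1 h.symm).resolve_right hc
  have hs : u ∈ Submodule.span ℝ (Set.range fun i => e i x) := by
    rw [hli.span_eq_top_of_card_eq_finrank' he.card_eq]; trivial
  obtain ⟨a, rfl⟩ := (Submodule.mem_span_range_iff_exists_fun ℝ).1 hs
  refine Finset.sum_congr rfl fun i _ => ?_
  rw [he.inner_sum, mul_comm, mul_assoc, mul_inv_cancel₀ hc, mul_one]

/-- Killing fields are divergence free, as the trace of a skew-symmetric map is zero. -/
theorem IsKillingFrame.divergence_eq_zero (he : IsKillingFrame g c e)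
    {X : Π x : M, TangentSpace I x} (hX : IsKilling g X) (x : M) : divergence g X x = 0 := by
  have h : (leviCivita g X x).toLinearMap = ∑ i, LinearMap.smulRight
      (c⁻¹ • ((g.inner x (e i x)).toLinearMap ∘ₗ (leviCivita g X x).toLinearMap))
        (e i x) := by
    ext v
    refine (he.eq_sum x (leviCivita g X x v)).trans ?_
    rw [LinearMap.sum_apply]
    refine Finset.sum_congr rfl fun i _ => ?_
    rw [g.symm]; rfl
  rw [divergence, h, map_sum]
  refine Finset.sum_eq_zero fun i _ => ?_
  rw [LinearMap.trace_smulRight]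
  have h1 := hX.skew x (e i x) (e i x)
  rw [g.symm x (leviCivita g X x (e i x))] at h1
  have h2 : g.inner x (e i x) (leviCivita g X x (e i x)) = 0 := by linarith
  change c⁻¹ * g.inner x (e i x) (leviCivita g X x (e i x)) = 0
  rw [h2, mul_zero]

/-- In a Killing frame the Laplacian has no first order terms. -/
theorem IsKillingFrame.laplacian_eq (he : IsKillingFrame g c e) {f : M → ℝ}
    (hf : ContMDiff I 𝓘(ℝ) ∞ f) (x : M) :
    laplacian g f x =
      - ∑ i, c⁻¹ * mvfderiv I (fun y => mvfderiv I f y (e i y)) x (e i x) := by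
  have hd : ∀ i, MDiffAt (fun y => mvfderiv I f y (e i y)) x := fun i =>
    mdiff_mvfderiv_apply (hf.contMDiffAt.of_le two_le_infty)
      ((he.isKilling i).smooth.mdifferentiableAt x)
  have hs : sharp g (mvfderiv I f) =
      ∑ i, (fun y => c⁻¹ * mvfderiv I f y (e i y)) • e i := by
    funext y
    refine (he.eq_sum y _).trans ?_
    rw [Finset.sum_apply]
    refine Finset.sum_congr rfl fun i _ => ?_
    rw [inner_sharp]; rfl
  have hd' : ∀ i, MDiffAt (fun y => c⁻¹ * mvfderiv I f y (e i y)) x := fun i =>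
    mdifferentiableAt_const.mul (hd i)
  rw [laplacian, codifferential, divergence, hs, leviCivita_sum_smul g _ hd'
    fun i => (he.isKilling i).smooth.mdifferentiableAt x, ContinuousLinearMap.toLinearMap_sum,
    map_sum]
  congr 1
  refine Finset.sum_congr rfl fun i _ => ?_
  have h0 := he.divergence_eq_zero (he.isKilling i) x
  have h1 : mvfderiv I (fun y => c⁻¹ * mvfderiv I f y (e i y)) x (e i x) =
      c⁻¹ * mvfderiv I (fun y => mvfderiv I f y (e i y)) x (e i x) := by
    rw [mvfderiv_fun_mul mdifferentiableAt_const (hd i), mvfderiv_const]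
    simp
  rw [← h1, ContinuousLinearMap.toLinearMap_add, map_add, ContinuousLinearMap.toLinearMap_smul,
    map_smul]
  change _ * divergence g (e i) x + LinearMap.trace ℝ _ (LinearMap.smulRight _ _) = _
  rw [h0, mul_zero, zero_add, LinearMap.trace_smulRight]
  rfl

end Frame

theorem exists_orthonormal_family (g : RiemMetric I M) (x : M) :
    ∃ b : Fin (Module.finrank ℝ E) → TangentSpace I x,
      (∀ i, g.inner x (b i) (b i) = 1) ∧ ∀ i j, i ≠ j → g.inner x (b i) (b j) = 0 := by
  let B : TangentSpace I x →ₗ[ℝ] TangentSpace I x →ₗ[ℝ] ℝ :=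
    ContinuousLinearMap.coeLM ℝ ∘ₗ (g.inner x).toLinearMap
  have hB : B.IsSymm := ⟨fun v w => g.symm x v w⟩
  obtain ⟨v, hv⟩ := LinearMap.BilinForm.exists_orthogonal_basis hB
  have hp : ∀ i, 0 < g.inner x (v i) (v i) := fun i => g.pos x _ (v.ne_zero i)
  refine ⟨fun i => (Real.sqrt (g.inner x (v i) (v i)))⁻¹ • v i, fun i => ?_, fun i j hij => ?_⟩
  · have h := Real.mul_self_sqrt (hp i).le
    have h' := Real.sqrt_pos.2 (hp i)
    simp only [map_smul, smul_apply, smul_eq_mul]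
    field_simp
    nlinarith
  · have : g.inner x (v i) (v j) = 0 := hv hij
    simp [this]

end Killing

/-! ### The multiplication map and the metric `2 (g ⊕ g)` -/

section Multiplication

variable {E : Type*} [NormedAddCommGroup E] [NormedSpace ℝ E] [FiniteDimensional ℝ E]
  {H : Type*} [TopologicalSpace H] {I : ModelWithCorners ℝ E H} [I.Boundaryless]
  {G : Type*} [TopologicalSpace G] [ChartedSpace H G] [Group G] [LieGroup I ∞ G]

theorem dLeft_injective (x y : G) : Function.Injective (dLeft I x y) := by
  refine (injective_iff_map_eq_zero _).2 fun v hv => ?_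
  have h := dLeft_dLeft y x x⁻¹ v
  rw [hv, map_zero] at h
  have e : (fun z : G => x⁻¹ * x * z) = id := by funext z; simp
  have h2 : (dLeft I (x⁻¹ * x) y v : E) = v := by
    rw [dLeft, e, mfderiv_id]; rfl
  exact h2.symm.trans h.symm

theorem dRight_injective (x y : G) : Function.Injective (dRight I x y) := by
  refine (injective_iff_map_eq_zero _).2 fun v hv => ?_
  have h := dRight_dRight y x x⁻¹ v
  rw [hv, map_zero] at h
  have e : (fun z : G => z * (x * x⁻¹)) = id := by funext z; simp
  have h2 : (dRight I (x * x⁻¹) y v : E) = v := by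
    rw [dRight, e, mfderiv_id]; rfl
  exact h2.symm.trans h.symm

theorem dLeft_surjective (x y : G) : Function.Surjective (dLeft I x y) :=
  let f : E →ₗ[ℝ] E := (dLeft I x y).toLinearMap
  LinearMap.surjective_of_injective (f := f) (dLeft_injective x y)

theorem dRight_surjective (x y : G) : Function.Surjective (dRight I x y) :=
  let f : E →ₗ[ℝ] E := (dRight I x y).toLinearMap
  LinearMap.surjective_of_injective (f := f) (dRight_injective x y)

theorem exists_leftField_eq (x : G) (v : TangentSpace I x) :
    ∃ a : TangentSpace I (1 : G), leftField a x = v := dLeft_surjective x 1 v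

theorem exists_rightField_eq (x : G) (v : TangentSpace I x) :
    ∃ a : TangentSpace I (1 : G), rightField a x = v := dRight_surjective x 1 v

@[simp] theorem leftField_zero (x : G) : leftField (I := I) 0 x = 0 := map_zero (dLeft I x 1)

@[simp] theorem rightField_zero (x : G) : rightField (I := I) 0 x = 0 := map_zero (dRight I x 1)

theorem mfderiv_mul_rightField_leftField (a b : TangentSpace I (1 : G)) (p : G × G) :
    mfderiv (I.prod I) I (fun q : G × G => q.1 * q.2) p (prodField (rightField a) (leftField b) p) =
      rightField a (p.1 * p.2) + leftField b (p.1 * p.2) := by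
  rw [mfderiv_mul_prodField, dRight_rightField, dLeft_leftField]

theorem mfderiv_mul_leftField_rightField (a : TangentSpace I (1 : G)) (p : G × G) :
    mfderiv (I.prod I) I (fun q : G × G => q.1 * q.2) p
      (prodField (leftField a) (rightField (-a)) p) = 0 := by
  rw [mfderiv_mul_prodField]
  have h := dLeft_dRight (I := I) p.1 1 p.2 a
  have k1 : ∀ z : G, z = p.2 → ∀ w : E, (dLeft I p.1 z w : E) = dLeft I p.1 p.2 w := by
    rintro z rfl w; rfl
  have k2 : ∀ z : G, z = p.1 → ∀ w : E, (dRight I p.2 z w : E) = dRight I p.2 p.1 w := by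
    rintro z rfl w; rfl
  have h' : dLeft I p.1 p.2 (rightField a p.2) = dRight I p.2 p.1 (leftField a p.1) :=
    (k1 _ (one_mul p.2) _).symm.trans (h.trans (k2 _ (mul_one p.1) _))
  have h'' : rightField (-a) p.2 = - rightField a p.2 := map_neg (dRight I p.2 1) a
  rw [h'', map_neg, h']
  exact add_neg_cancel _

/-- A tangent vector of `G × G` is determined by its first component and its image under the
differential of the multiplication. -/
theorem eq_of_mfderiv_mul_eq {p : G × G} {U U' : TangentSpace (I.prod I) p}
    (h1 : mfderiv (I.prod I) I Prod.fst p U = mfderiv (I.prod I) I Prod.fst p U')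
    (h2 : mfderiv (I.prod I) I (fun q : G × G => q.1 * q.2) p U =
      mfderiv (I.prod I) I (fun q : G × G => q.1 * q.2) p U') : U = U' := by
  rw [mfderiv_mul, mfderiv_mul, h1] at h2
  have h3 := dLeft_injective _ _ (add_left_cancel h2)
  rw [mfderiv_fst] at h1
  rw [mfderiv_snd] at h3
  exact Prod.ext h1 h3

/-- The fields `(L_a, R_{-a})` span the vertical spaces of the multiplication. -/
theorem exists_leftField_rightField_eq {p : G × G} {U : TangentSpace (I.prod I) p}
    (hU : U ∈ vertical (I.prod I) I (fun q : G × G => q.1 * q.2) p) :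
    ∃ a : TangentSpace I (1 : G), prodField (leftField a) (rightField (-a)) p = U := by
  obtain ⟨a, ha⟩ := exists_leftField_eq p.1 (mfderiv (I.prod I) I Prod.fst p U)
  refine ⟨a, eq_of_mfderiv_mul_eq ?_ ?_⟩
  · rw [mfderiv_fst_prodField, ha]
  · rw [mfderiv_mul_leftField_rightField]; exact hU.symm

/-- A function that vanishes on a fiber of the multiplication has no derivative along the fiber. -/
theorem mvfderiv_eq_zero_of_vertical {b : G} {k : G × G → ℝ} (hk : ∀ q, q.1 * q.2 = b → k q = 0)
    {p : G × G} (hp : p.1 * p.2 = b) (hd : MDiffAt k p) {v : TangentSpace (I.prod I) p}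
    (hv : v ∈ vertical (I.prod I) I (fun q : G × G => q.1 * q.2) p) :
    mvfderiv (I.prod I) k p v = 0 := by
  obtain ⟨x, y⟩ := p
  obtain rfl : y = x⁻¹ * b := by rw [← hp]; simp
  -- The fiber over `b` is parametrized by its first component.
  let c : G → G × G := fun t => (t, t⁻¹ * b)
  have hinv : ContMDiff I I ∞ (fun t : G => t⁻¹ * b) := (contMDiff_inv I ∞).mul contMDiff_const
  have hc : MDiffAt c x :=
    (contMDiff_id.prodMk hinv).mdifferentiableAt (n := ∞) (by simp)
  set u := mfderiv (I.prod I) I Prod.fst (x, x⁻¹ * b) v with hu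
  have e : mfderiv I (I.prod I) c x u = v := by
    refine eq_of_mfderiv_mul_eq (p := (x, x⁻¹ * b)) ?_ ?_
    · have h := mfderiv_comp_apply (I := I) (I' := I.prod I) (I'' := I) x (f := c) (g := Prod.fst)
        mdifferentiableAt_fst hc u
      refine h.symm.trans ?_
      have : Prod.fst ∘ c = id := rfl
      rw [this, mfderiv_id]; exact hu
    · have h := mfderiv_comp_apply (I := I) (I' := I.prod I) (I'' := I) x (f := c)
        (g := fun q : G × G => q.1 * q.2)
        ((contMDiff_mul I ∞).mdifferentiableAt (by simp)) hc u
      refine h.symm.trans (Eq.trans ?_ (Eq.symm hv))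
      have : (fun q : G × G => q.1 * q.2) ∘ c = fun _ => b := by funext t; simp [c]
      rw [this, mfderiv_const]; rfl
  have h := mvfderiv_comp_apply (I := I.prod I) (I' := I) x (f := c) (g := k) hd hc u
  have h0 : k ∘ c = fun _ => (0 : ℝ) := funext fun t => hk _ (by simp [c])
  rw [h0, mvfderiv_const] at h
  rw [← e]
  exact h.symm

section Metric

variable {g : RiemMetric I G}

/-- The metric `2 (g ⊕ g)` on `G × G`. -/
noncomputable abbrev doubleMetric (g : RiemMetric I G) : RiemMetric (I.prod I) (G × G) :=
  RiemMetric.scale 2 two_pos (RiemMetric.prod g g)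

theorem inner_doubleMetric (p : G × G) (U V : TangentSpace (I.prod I) p) :
    (doubleMetric g).inner p U V =
      2 * (g.inner p.1 (mfderiv (I.prod I) I Prod.fst p U) (mfderiv (I.prod I) I Prod.fst p V) +
        g.inner p.2 (mfderiv (I.prod I) I Prod.snd p U) (mfderiv (I.prod I) I Prod.snd p V)) := rfl

theorem inner_doubleMetric_prodField (X X' Y Y' : Π x : G, TangentSpace I x) (p : G × G) :
    (doubleMetric g).inner p (prodField X Y p) (prodField X' Y' p) =
      2 * (g.inner p.1 (X p.1) (X' p.1) + g.inner p.2 (Y p.2) (Y' p.2)) := by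
  rw [inner_doubleMetric]
  simp only [mfderiv_fst_prodField, mfderiv_snd_prodField]

theorem inner_congr_point (g : RiemMetric I G) {x y : G} (h : x = y) (v w : E) :
    g.inner x v w = g.inner y v w := by
  subst h; rfl

theorem IsBiInvariant.inner_dLeft (hg : IsBiInvariant g) (x y : G) (v w : TangentSpace I y) :
    g.inner (x * y) (dLeft I x y v) (dLeft I x y w) = g.inner y v w := hg.left x y v w

theorem IsBiInvariant.inner_dRight (hg : IsBiInvariant g) (x y : G) (v w : TangentSpace I y) :
    g.inner (y * x) (dRight I x y v) (dRight I x y w) = g.inner y v w := hg.right x y v w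

theorem IsBiInvariant.inner_leftField (hg : IsBiInvariant g) (v w : TangentSpace I (1 : G))
    (x : G) : g.inner x (leftField v x) (leftField w x) = g.inner 1 v w :=
  (inner_congr_point g (mul_one x).symm _ _).trans (hg.inner_dLeft x 1 v w)

theorem IsBiInvariant.inner_rightField (hg : IsBiInvariant g) (v w : TangentSpace I (1 : G))
    (x : G) : g.inner x (rightField v x) (rightField w x) = g.inner 1 v w :=
  (inner_congr_point g (one_mul x).symm _ _).trans (hg.inner_dRight x 1 v w)

theorem hasCommutingFrames_leftField (hg : IsBiInvariant g) (a : TangentSpace I (1 : G)) :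
    HasCommutingFrames g (leftField a) := by
  refine ⟨isSmoothVF_leftField a, fun x v w => ?_⟩
  obtain ⟨b, rfl⟩ := exists_rightField_eq x v
  obtain ⟨c, rfl⟩ := exists_rightField_eq x w
  refine ⟨_, _, isSmoothVF_rightField b, isSmoothVF_rightField c, rfl, rfl, ?_, ?_, ?_⟩
  · rw [mlieBracket_leftField_rightField]; rfl
  · rw [mlieBracket_leftField_rightField]; rfl
  · simp only [hg.inner_rightField, mvfderiv_const, zero_apply]

theorem hasCommutingFrames_rightField (hg : IsBiInvariant g) (a : TangentSpace I (1 : G)) :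
    HasCommutingFrames g (rightField a) := by
  refine ⟨isSmoothVF_rightField a, fun x v w => ?_⟩
  obtain ⟨b, rfl⟩ := exists_leftField_eq x v
  obtain ⟨c, rfl⟩ := exists_leftField_eq x w
  refine ⟨_, _, isSmoothVF_leftField b, isSmoothVF_leftField c, rfl, rfl, ?_, ?_, ?_⟩
  · rw [mlieBracket_swap_apply, mlieBracket_leftField_rightField]; exact neg_zero
  · rw [mlieBracket_swap_apply, mlieBracket_leftField_rightField]; exact neg_zero
  · simp only [hg.inner_leftField, mvfderiv_const, zero_apply]

theorem HasCommutingFrames.prodField {X Y : Π x : G, TangentSpace I x}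
    (hX : HasCommutingFrames g X) (hY : HasCommutingFrames g Y) :
    HasCommutingFrames (doubleMetric g) (prodField X Y) := by
  refine ⟨hX.smooth.prodField hY.smooth, fun p v w => ?_⟩
  obtain ⟨A, B, hA, hB, eA, eB, cA, cB, cAB⟩ := hX.exists_fields p.1
    (mfderiv (I.prod I) I Prod.fst p v) (mfderiv (I.prod I) I Prod.fst p w)
  obtain ⟨A', B', hA', hB', eA', eB', cA', cB', cAB'⟩ := hY.exists_fields p.2
    (mfderiv (I.prod I) I Prod.snd p v) (mfderiv (I.prod I) I Prod.snd p w)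
  rw [mfderiv_fst] at eA eB
  rw [mfderiv_snd] at eA' eB'
  refine ⟨_, _, hA.prodField hA', hB.prodField hB', Prod.ext eA eA', Prod.ext eB eB', ?_, ?_, ?_⟩
  · rw [mlieBracket_prodField hX.smooth hA hY.smooth hA']
    exact Prod.ext cA cA'
  · rw [mlieBracket_prodField hX.smooth hB hY.smooth hB']
    exact Prod.ext cB cB'
  · simp only [inner_doubleMetric_prodField]
    have d1 : MDiffAt (fun x => g.inner x (A x) (B x)) p.1 :=
      mdiff_inner g (hA.mdifferentiableAt _) (hB.mdifferentiableAt _)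
    have d2 : MDiffAt (fun x => g.inner x (A' x) (B' x)) p.2 :=
      mdiff_inner g (hA'.mdifferentiableAt _) (hB'.mdifferentiableAt _)
    have h1 := mvfderiv_comp_apply (I := I) (I' := I.prod I) p (f := Prod.fst) d1
      mdifferentiableAt_fst (RiemGeom.prodField X Y p)
    have h2 := mvfderiv_comp_apply (I := I) (I' := I.prod I) p (f := Prod.snd) d2
      mdifferentiableAt_snd (RiemGeom.prodField X Y p)
    rw [mfderiv_fst_prodField, cAB] at h1
    rw [mfderiv_snd_prodField, cAB'] at h2
    have d1' : MDiffAt ((fun x => g.inner x (A x) (B x)) ∘ (Prod.fst : G × G → G)) p :=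
      d1.comp p mdifferentiableAt_fst
    have d2' : MDiffAt ((fun x => g.inner x (A' x) (B' x)) ∘ (Prod.snd : G × G → G)) p :=
      d2.comp p mdifferentiableAt_snd
    have h3 := mvfderiv_fun_mul (mdifferentiableAt_const (c := (2 : ℝ))) (d1'.add d2')
    rw [mvfderiv_const, mvfderiv_add d1' d2'] at h3
    have h4 := congrArg (fun T => T (RiemGeom.prodField X Y p)) h3
    refine h4.trans ?_
    simp only [add_apply, smul_apply, h1, h2]
    simp

end Metric

end Multiplication

/-! ### The three properties of the multiplication -/

section Conclusion

variable {E : Type*} [NormedAddCommGroup E] [NormedSpace ℝ E] [FiniteDimensional ℝ E]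
  {H : Type*} [TopologicalSpace H] {I : ModelWithCorners ℝ E H} [I.Boundaryless]
  {G : Type*} [TopologicalSpace G] [ChartedSpace H G] [Group G] [LieGroup I ∞ G]
  {g : RiemMetric I G}

/-- The metric `2 (g ⊕ g)` at `(x, y)` after translation of both components to `T_{xy} G`. -/
theorem IsBiInvariant.inner_doubleMetric (hg : IsBiInvariant g) (p : G × G)
    (U V : TangentSpace (I.prod I) p) :
    (doubleMetric g).inner p U V = 2 *
      (g.inner (p.1 * p.2) (dRight I p.2 p.1 (mfderiv (I.prod I) I Prod.fst p U))
          (dRight I p.2 p.1 (mfderiv (I.prod I) I Prod.fst p V)) +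
        g.inner (p.1 * p.2) (dLeft I p.1 p.2 (mfderiv (I.prod I) I Prod.snd p U))
          (dLeft I p.1 p.2 (mfderiv (I.prod I) I Prod.snd p V))) := by
  rw [hg.inner_dRight, hg.inner_dLeft, RiemGeom.inner_doubleMetric]

/-- A vector with prescribed components after translation to `T_{xy} G`. -/
theorem exists_dRight_dLeft_eq (p : G × G) (a b : TangentSpace I (p.1 * p.2)) :
    ∃ U : TangentSpace (I.prod I) p,
      dRight I p.2 p.1 (mfderiv (I.prod I) I Prod.fst p U) = a ∧
      dLeft I p.1 p.2 (mfderiv (I.prod I) I Prod.snd p U) = b := by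
  obtain ⟨u, hu⟩ := dRight_surjective p.2 p.1 a
  obtain ⟨w, hw⟩ := dLeft_surjective p.1 p.2 b
  refine ⟨(u, w), ?_, ?_⟩
  · rw [mfderiv_fst]; exact hu
  · rw [mfderiv_snd]; exact hw

theorem IsBiInvariant.mem_horizontal_iff (hg : IsBiInvariant g) (p : G × G)
    (U : TangentSpace (I.prod I) p) :
    U ∈ horizontal I (doubleMetric g) (fun q : G × G => q.1 * q.2) p ↔
      dRight I p.2 p.1 (mfderiv (I.prod I) I Prod.fst p U) =
        dLeft I p.1 p.2 (mfderiv (I.prod I) I Prod.snd p U) := by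
  constructor
  · intro h
    rw [← sub_eq_zero]
    set a := dRight I p.2 p.1 (mfderiv (I.prod I) I Prod.fst p U) with ha
    set b := dLeft I p.1 p.2 (mfderiv (I.prod I) I Prod.snd p U) with hb
    -- Orthogonality to the vertical vector `(a - b, -(a - b))` gives `|a - b|² = 0`.
    obtain ⟨V, hV1, hV2⟩ := exists_dRight_dLeft_eq p (a - b) (-(a - b))
    have hV : V ∈ vertical (I.prod I) I (fun q : G × G => q.1 * q.2) p := by
      change mfderiv (I.prod I) I (fun q : G × G => q.1 * q.2) p V = 0
      rw [mfderiv_mul, hV1, hV2]; exact add_neg_cancel _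
    have h0 := h V hV
    rw [hg.inner_doubleMetric, hV1, hV2, ← ha, ← hb] at h0
    have h1 : g.inner (p.1 * p.2) (a - b) (a - b) = 0 := by
      rw [map_neg] at h0
      have e : g.inner (p.1 * p.2) (a - b) (a - b) =
          g.inner (p.1 * p.2) a (a - b) - g.inner (p.1 * p.2) b (a - b) := by
        rw [map_sub (g.inner (p.1 * p.2)) a b]; rfl
      linarith
    by_contra hne
    exact (g.pos _ _ hne).ne' h1
  · intro h V hV
    have hV' : mfderiv (I.prod I) I (fun q : G × G => q.1 * q.2) p V = 0 := hV
    rw [mfderiv_mul] at hV'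
    rw [hg.inner_doubleMetric, h, ← map_add, hV', map_zero, mul_zero]

theorem isRiemannianSubmersion_mul (hg : IsBiInvariant g) :
    IsRiemannianSubmersion (doubleMetric g) g (fun p : G × G => p.1 * p.2) where
  smooth := contMDiff_mul I ∞
  surjective h := ⟨(h, 1), mul_one h⟩
  submersion p z := by
    obtain ⟨U, h1, h2⟩ := exists_dRight_dLeft_eq p z 0
    exact ⟨U, by rw [mfderiv_mul, h1, h2]; exact add_zero _⟩
  surjOn p z _ := by
    obtain ⟨U, h1, h2⟩ := exists_dRight_dLeft_eq (I := I) p ((2 : ℝ)⁻¹ • z) ((2 : ℝ)⁻¹ • z)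
    refine ⟨U, (hg.mem_horizontal_iff p U).2 (h1.trans h2.symm), ?_⟩
    rw [mfderiv_mul, h1, h2, ← add_smul]
    norm_num
  isometry p u hu v hv := by
    rw [hg.mem_horizontal_iff] at hu hv
    rw [hg.inner_doubleMetric, mfderiv_mul, mfderiv_mul, hu, hv]
    simp only [map_add, add_apply]
    ring

theorem isKilling_prodField_rightField_leftField (hg : IsBiInvariant g)
    (a b : TangentSpace I (1 : G)) :
    IsKilling (doubleMetric g) (prodField (rightField a) (leftField b)) :=
  ((hasCommutingFrames_rightField hg a).prodField (hasCommutingFrames_leftField hg b)).isKilling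

theorem isKilling_prodField_leftField_rightField (hg : IsBiInvariant g)
    (a b : TangentSpace I (1 : G)) :
    IsKilling (doubleMetric g) (prodField (leftField a) (rightField b)) :=
  ((hasCommutingFrames_leftField hg a).prodField (hasCommutingFrames_rightField hg b)).isKilling

/-- An orthonormal basis of the Lie algebra gives Killing frames of left-invariant and of
right-invariant fields on `G`, and a Killing frame on `G × G` whose members are related by the
multiplication to the members of the other two. -/
theorem exists_isKillingFrame_mul (hg : IsBiInvariant g) :
    ∃ b : Fin (Module.finrank ℝ E) → TangentSpace I (1 : G),
      IsKillingFrame g 1 (fun i => leftField (b i)) ∧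
      IsKillingFrame g 1 (fun i => rightField (b i)) ∧
      IsKillingFrame (doubleMetric g) 2
        (fun s : Fin (Module.finrank ℝ E) ⊕ Fin (Module.finrank ℝ E) =>
          prodField (rightField (Sum.elim b 0 s)) (leftField (Sum.elim 0 b s))) := by
  obtain ⟨b, h1, h2⟩ := exists_orthonormal_family g (1 : G)
  refine ⟨b, ⟨one_pos, fun i => (hasCommutingFrames_leftField hg _).isKilling,
    fun i x => by rw [hg.inner_leftField, h1],
    fun i j hij x => by rw [hg.inner_leftField, h2 i j hij], by simp⟩,
    ⟨one_pos, fun i => (hasCommutingFrames_rightField hg _).isKilling,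
    fun i x => by rw [hg.inner_rightField, h1],
    fun i j hij x => by rw [hg.inner_rightField, h2 i j hij], by simp⟩,
    ⟨two_pos, fun s => isKilling_prodField_rightField_leftField hg _ _, fun s p => ?_,
    fun s t hst p => ?_, by simp [Module.finrank_prod]⟩⟩
  · rw [inner_doubleMetric_prodField, hg.inner_rightField, hg.inner_leftField]
    rcases s with i | i <;> simp [h1]
  · rw [inner_doubleMetric_prodField, hg.inner_rightField, hg.inner_leftField]
    rcases s with i | i <;> rcases t with j | j
    · have := h2 i j (fun h => hst (by rw [h]))
      simp [this]
    · simp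
    · simp
    · have := h2 i j (fun h => hst (by rw [h]))
      simp [this]

/-- For the vertical Killing fields `V_a = (L_a, R_{-a})` the field `∇_{V_a} V_b` is vertical: it is
half of the bracket `[V_a, V_b]`. -/
theorem mfderiv_mul_leviCivita (hg : IsBiInvariant g) (a b : TangentSpace I (1 : G)) (p : G × G) :
    mfderiv (I.prod I) I (fun q : G × G => q.1 * q.2) p
      (leviCivita (doubleMetric g) (prodField (leftField b) (rightField (-b))) p
        (prodField (leftField a) (rightField (-a)) p)) = 0 := by
  have ka := isKilling_prodField_leftField_rightField hg a (-a)
  have kb := isKilling_prodField_leftField_rightField hg b (-b)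
  have hc : ∀ c d : TangentSpace I (1 : G), ∀ x y : G × G,
      (doubleMetric g).inner x (prodField (leftField c) (rightField (-c)) x)
        (prodField (leftField d) (rightField (-d)) x) =
      (doubleMetric g).inner y (prodField (leftField c) (rightField (-c)) y)
        (prodField (leftField d) (rightField (-d)) y) := fun c d x y => by
    simp only [inner_doubleMetric_prodField, hg.inner_leftField, hg.inner_rightField]
  have h1 := leviCivita_add_leviCivita_of_isKilling ka kb (hc a a) (hc b b) (hc a b) p
  have h2 := leviCivita_sub_leviCivita (doubleMetric g) ka.smooth kb.smooth p
  have h3 := mfderiv_mlieBracket_of_related (contMDiff_mul I ∞ (G := G)) (x := p)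
    (V' := 0) (W' := 0) (ka.smooth.mdifferentiableAt p) (kb.smooth.mdifferentiableAt p)
    (isSmoothVF_zero.mdifferentiableAt _) (isSmoothVF_zero.mdifferentiableAt _)
    (mfderiv_mul_leftField_rightField a) (mfderiv_mul_leftField_rightField b)
  rw [mlieBracket_zero_left, ← h2, map_sub] at h3
  have h4 := congrArg (mfderiv (I.prod I) I (fun q : G × G => q.1 * q.2) p) h1
  rw [map_add, map_zero] at h4
  have h5 := sub_eq_zero.1 h3
  rw [← h5, ← two_smul ℝ] at h4
  exact (smul_eq_zero.1 h4).resolve_left two_ne_zero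

theorem mvfderiv_sum_mul_const {M : Type*} [TopologicalSpace M] [ChartedSpace H M] {ι : Type*}
    (s : Finset ι) {h : ι → M → ℝ} (a : ι → ℝ) {x : M} (hd : ∀ i, MDiffAt (h i) x)
    (v : TangentSpace I x) :
    MDiffAt (fun y => ∑ i ∈ s, h i y * a i) x ∧
    mvfderiv I (fun y => ∑ i ∈ s, h i y * a i) x v = ∑ i ∈ s, mvfderiv I (h i) x v * a i := by
  classical
  induction s using Finset.induction_on with
  | empty => simpa using ⟨mdifferentiableAt_const, by rw [mvfderiv_const]; rfl⟩
  | insert j s hj ih =>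
    simp only [Finset.sum_insert hj]
    have h1 : MDiffAt (fun y => h j y * a j) x := (hd j).mul mdifferentiableAt_const
    refine ⟨h1.add ih.1, ?_⟩
    rw [mvfderiv_fun_add h1 ih.1, add_apply, ih.2, mvfderiv_fun_mul (hd j) mdifferentiableAt_const,
      mvfderiv_const]
    simp [mul_comm]

/-- At a zero of `Y`, the derivative `∇_v Y` is vertical if `Y` is tangent to the fiber. -/
theorem mfderiv_mul_leviCivita_of_eq_zero (hg : IsBiInvariant g) {b : G}
    {Y : Π p : G × G, TangentSpace (I.prod I) p} (hY : IsSmoothVF (I := I.prod I) Y)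
    (hv : ∀ q, q.1 * q.2 = b → Y q ∈ vertical (I.prod I) I (fun q : G × G => q.1 * q.2) q)
    {p : G × G} (hp : p.1 * p.2 = b) (h0 : Y p = 0) {v : TangentSpace (I.prod I) p}
    (hvp : v ∈ vertical (I.prod I) I (fun q : G × G => q.1 * q.2) p) :
    mfderiv (I.prod I) I (fun q : G × G => q.1 * q.2) p
      (leviCivita (doubleMetric g) Y p v) = 0 := by
  obtain ⟨a, -, -, he⟩ := exists_isKillingFrame_mul hg
  let ι := Fin (Module.finrank ℝ E) ⊕ Fin (Module.finrank ℝ E)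
  let A : ι → TangentSpace I (1 : G) := Sum.elim a 0
  let B : ι → TangentSpace I (1 : G) := Sum.elim 0 a
  let e : ι → Π q : G × G, TangentSpace (I.prod I) q := fun s =>
    prodField (rightField (A s)) (leftField (B s))
  change IsKillingFrame (doubleMetric g) 2 e at he
  let h : ι → G × G → ℝ := fun s q => (2 : ℝ)⁻¹ * (doubleMetric g).inner q (Y q) (e s q)
  have hsm : ∀ s q, MDiffAt (T% (e s)) q := fun s q => (he.isKilling s).smooth.mdifferentiableAt q
  have hd : ∀ s q, MDiffAt (h s) q := fun s q =>
    mdifferentiableAt_const.mul (mdiff_inner _ (hY.mdifferentiableAt q) (hsm s q))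
  have hYe : Y = ∑ s, h s • e s := by
    funext q
    rw [Finset.sum_apply]
    exact he.eq_sum q (Y q)
  have hm : ∀ q s, mfderiv (I.prod I) I (fun q : G × G => q.1 * q.2) q (e s q) =
      rightField (A s) (q.1 * q.2) + leftField (B s) (q.1 * q.2) := fun q s =>
    mfderiv_mul_rightField_leftField _ _ q
  have hz : ∀ s, h s p = 0 := fun s => by
    simp only [h, h0, map_zero, zero_apply, mul_zero]
  rw [hYe, leviCivita_sum_smul _ _ (fun s => hd s p) (fun s => hsm s p), sum_apply, map_sum]
  -- As `Y p = 0`, only the derivatives of the coefficients `h s` remain. Along the fiber, a linear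
  -- form `l` composed with `dm Y` is the combination of the `h s` with constant weights in `hk`.
  refine (SeparatingDual.eq_iff_forall_dual_eq (R := ℝ) (V := E)).2 fun l => ?_
  subst hp
  obtain ⟨hk, hk'⟩ := mvfderiv_sum_mul_const (I := I.prod I) Finset.univ (h := h)
    (fun s => l (rightField (A s) (p.1 * p.2) + leftField (B s) (p.1 * p.2))) (fun s => hd s p) v
  have key := mvfderiv_eq_zero_of_vertical (b := p.1 * p.2) (p := p) (v := v) ?_ rfl hk hvp
  · rw [hk'] at key
    refine Eq.trans ?_ (key.trans (map_zero l).symm)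
    refine (map_sum l _ _).trans (Finset.sum_congr rfl fun s _ => ?_)
    rw [hz, zero_smul, zero_add]
    have : mfderiv (I.prod I) I (fun q : G × G => q.1 * q.2) p
      ((mvfderiv (I.prod I) (h s) p).smulRight (e s p) v) = mvfderiv (I.prod I) (h s) p v •
      (rightField (A s) (p.1 * p.2) + leftField (B s) (p.1 * p.2)) := by
      rw [ContinuousLinearMap.smulRight_apply, map_smul, hm]
    rw [this]
    exact map_smul l _ _
  · intro q hq
    have h1 : mfderiv (I.prod I) I (fun q : G × G => q.1 * q.2) q (Y q) = 0 := hv q hq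
    rw [hYe, Finset.sum_apply, map_sum] at h1
    have h2 := congrArg l h1
    refine Eq.trans ?_ (h2.trans (map_zero l))
    refine Eq.trans ?_ (map_sum l _ _).symm
    refine Finset.sum_congr rfl fun s _ => ?_
    have : mfderiv (I.prod I) I (fun q : G × G => q.1 * q.2) q ((h s • e s) q) = h s q •
      (rightField (A s) (q.1 * q.2) + leftField (B s) (q.1 * q.2)) := by
      rw [Pi.smul_apply', map_smul, hm]
    rw [this, ← hq]
    exact (map_smul l _ _).symm

theorem hasTotallyGeodesicFibers_mul (hg : IsBiInvariant g) :
    HasTotallyGeodesicFibers I (doubleMetric g) (fun p : G × G => p.1 * p.2) := by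
  intro b Y hY hYv p hp v hv
  obtain ⟨a, rfl⟩ := exists_leftField_rightField_eq hv
  -- The vertical Killing field `W` is chosen so that `Y + W` vanishes at `p`.
  obtain ⟨c, hc⟩ := exists_leftField_rightField_eq (neg_mem (hYv p hp))
  set W : Π q : G × G, TangentSpace (I.prod I) q := prodField (leftField c) (rightField (-c))
  have hW : IsSmoothVF (I := I.prod I) W :=
    (isSmoothVF_leftField c).prodField (isSmoothVF_rightField (-c))
  have h1 := mfderiv_mul_leviCivita hg a c p
  have h2 := mfderiv_mul_leviCivita_of_eq_zero hg (b := b) (Y := Y + W)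
    (fun x => ContMDiffAt.add_section (hY x) (hW x))
    (fun q hq => add_mem (hYv q hq) (mfderiv_mul_leftField_rightField c q)) hp
    (by rw [Pi.add_apply, hc, add_neg_cancel]) hv
  rw [leviCivita_add _ (hY.mdifferentiableAt p) (hW.mdifferentiableAt p), add_apply, map_add,
    h1] at h2
  exact (add_zero _).symm.trans h2

/-- The Laplacian of `f ∘ m` is half the sum of the expressions of `Δ f` in a right-invariant and in
a left-invariant frame. -/
theorem laplacian_comp_mul (hg : IsBiInvariant g) {f : G → ℝ} (hf : ContMDiff I 𝓘(ℝ) ∞ f)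
    (p : G × G) :
    laplacian (doubleMetric g) (f ∘ fun q : G × G => q.1 * q.2) p = laplacian g f (p.1 * p.2) := by
  obtain ⟨b, hL, hR, hLR⟩ := exists_isKillingFrame_mul hg
  have hm : ContMDiff (I.prod I) I ∞ (fun q : G × G => q.1 * q.2) := contMDiff_mul I ∞
  have dm : ∀ q, MDiffAt (fun q : G × G => q.1 * q.2) q := fun q => hm.mdifferentiableAt (by simp)
  have push : ∀ (k : G → ℝ) (_ : ∀ x, MDiffAt k x) (a c : TangentSpace I (1 : G)) (q : G × G),
      mvfderiv (I.prod I) (k ∘ fun q : G × G => q.1 * q.2) q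
        (prodField (rightField a) (leftField c) q) =
      mvfderiv I k (q.1 * q.2) (rightField a (q.1 * q.2) + leftField c (q.1 * q.2)) :=
    fun k hk a c q => by
      rw [mvfderiv_comp_apply (I := I) (I' := I.prod I) q (hk _) (dm q),
        mfderiv_mul_rightField_leftField]
  have df : ∀ x, MDiffAt f x := fun x => hf.mdifferentiableAt (by simp)
  have d1 : ∀ (X : Π x : G, TangentSpace I x), IsSmoothVF X →
      ∀ x, MDiffAt (fun y => mvfderiv I f y (X y)) x := fun X hX x =>
    mdiff_mvfderiv_apply (hf.contMDiffAt.of_le two_le_infty) (hX.mdifferentiableAt x)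
  have second : ∀ (a c : TangentSpace I (1 : G)) (X : Π x : G, TangentSpace I x), IsSmoothVF X →
      (∀ x, rightField a x + leftField c x = X x) →
      mvfderiv (I.prod I) (fun q => mvfderiv (I.prod I) (f ∘ fun q : G × G => q.1 * q.2) q
        (prodField (rightField a) (leftField c) q)) p (prodField (rightField a) (leftField c) p) =
      mvfderiv I (fun x => mvfderiv I f x (X x)) (p.1 * p.2) (X (p.1 * p.2)) := by
    intro a c X hX e
    simp only [push f df, e]
    have := push _ (d1 X hX) a c p
    rw [e] at this
    exact this
  rw [hLR.laplacian_eq (hf.comp hm), Fintype.sum_sum_type]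
  have h1 := hL.laplacian_eq hf (p.1 * p.2)
  have h2 := hR.laplacian_eq hf (p.1 * p.2)
  have s1 : ∀ i, _ := fun i => second (b i) 0 (rightField (b i)) (isSmoothVF_rightField _)
    (fun x => by rw [leftField_zero, add_zero])
  have s2 : ∀ i, _ := fun i => second 0 (b i) (leftField (b i)) (isSmoothVF_leftField _)
    (fun x => by rw [rightField_zero, zero_add])
  simp only [Sum.elim_inl, Sum.elim_inr, Pi.zero_apply, s1, s2, ← Finset.mul_sum]
  simp only [← Finset.mul_sum] at h1 h2
  linarith

theorem complexLaplacian_comp_mul (hg : IsBiInvariant g) {φ : G → ℂ}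
    (hφ : ContMDiff I 𝓘(ℝ, ℂ) ∞ φ) (p : G × G) :
    complexLaplacian (doubleMetric g) (φ ∘ fun q : G × G => q.1 * q.2) p =
      complexLaplacian g φ (p.1 * p.2) := by
  have h1 := laplacian_comp_mul hg (f := fun x => (φ x).re)
    (Complex.reCLM.contDiff.contMDiff.comp hφ) p
  have h2 := laplacian_comp_mul hg (f := fun x => (φ x).im)
    (Complex.imCLM.contDiff.contMDiff.comp hφ) p
  rw [complexLaplacian, complexLaplacian, ← h1, ← h2]
  rfl

end Conclusion

end RiemGeom

theorem theorem1p1 {E : Type*} [NormedAddCommGroup E] [NormedSpace ℝ E] [FiniteDimensional ℝ E]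
    {H : Type*} [TopologicalSpace H] (I : ModelWithCorners ℝ E H) [I.Boundaryless]
    {G : Type*} [TopologicalSpace G] [ChartedSpace H G] [Group G] [LieGroup I ∞ G] [CompactSpace G]
    (g : RiemGeom.RiemMetric I G) (hg : RiemGeom.IsBiInvariant g) :
    let gGG : RiemGeom.RiemMetric (I.prod I) (G × G) :=
      RiemGeom.RiemMetric.scale 2 two_pos (RiemGeom.RiemMetric.prod g g)
    let m : G × G → G := fun p => p.1 * p.2
    RiemGeom.IsRiemannianSubmersion gGG g m ∧
      RiemGeom.HasTotallyGeodesicFibers I gGG m ∧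
      ∀ c : ℝ, (fun φ : G → ℂ => φ ∘ m) '' RiemGeom.eigenspace g c ⊆
        RiemGeom.eigenspace gGG c := by
  intro gGG m
  refine ⟨RiemGeom.isRiemannianSubmersion_mul hg, RiemGeom.hasTotallyGeodesicFibers_mul hg, ?_⟩
  rintro c _ ⟨φ, ⟨hφ, he⟩, rfl⟩
  exact ⟨hφ.comp (contMDiff_mul I ∞), fun p =>
    (RiemGeom.complexLaplacian_comp_mul hg hφ p).trans (he _)⟩
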